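/- Let $d\ge 1$ be an integer, let $\theta(x)=|x|^2/4$ for $x\in\mathbb{R}^d$ ($|\cdot|$ the Euclidean norm), and for $p\in[1,\infty]$ let $L^p(e^{\theta})$ be the Lebesgue space of real-valued functions (or, for gradients, $\mathbb{R}^d$-valued functions) on $\mathbb{R}^d$ with respect to the measure $e^{\theta(x)}\,dx$. Let $H^1(e^{\theta})$ be the space of all $u\in L^2(e^{\theta})$ whose weak gradient $\nabla u$ on $\mathbb{R}^d$ belongs to $L^2(e^{\theta})$. With the convention $1/\infty=0$, put $a=1+d\left(\tfrac1p-\tfrac12\right)$. Then for all $u\in H^1(e^{\theta})$ $$\|u\|_{L^p(e^{\theta})}\ \le\ \big\|e^{(1/2-1/p)\theta}u\big\|_{L^p(e^{\theta})}\ \le\ C(d,p)\,\|u\|_{L^2(e^{\theta})}^{a}\,\|\nabla u\|_{L^2(e^{\theta})}^{1-a}$$ (in particular these norms are finite; $0^0=1$) in each of the following cases: - $d=1$, $p\in[2,\infty]$, with $C(1,p)=2^{1/2-1/p}$; - $d=2$, $p\in[2,\infty)$, with, writing $p=2(k+r)$ where $k\ge 1$ is an integer and $r\in[0,1)$, $$C(2,2(k+r))=(k!)^{1/(k+r)}\,(k+1)^{r/(k+r)};$$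 - $d\ge 3$, $p\in\left[2,\tfrac{2d}{d-2}\right]$, with $$C(d,p)=\left(\frac{1}{d(d-2)\pi}\right)^{(1-a)/2}\left\{\frac{(d-1)!}{\Gamma(d/2)}\right\}^{1/2-1/p}.$$ -/

import Mathlib

open MeasureTheory
open scoped ENNReal ContDiff Nat

/-- The function `θ(x) = |x|² / 4` on `ℝ^d` (Euclidean norm). -/
noncomputable def theta {d : ℕ} (x : EuclideanSpace ℝ (Fin d)) : ℝ := ‖x‖ ^ 2 / 4

/-- The measure `e^θ dx` on `ℝ^d`; the spaces `L^p(e^θ)` are its Lebesgue spaces. -/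
noncomputable def expThetaMeasure (d : ℕ) : Measure (EuclideanSpace ℝ (Fin d)) :=
  volume.withDensity fun x => ENNReal.ofReal (Real.exp (theta x))

/-- `g` is a weak (distributional) gradient of `u` on `ℝ^d`: both are locally integrable for the
Lebesgue measure, and `∫ u ∂ᵢη = - ∫ gᵢ η` for every `i` and every test function
`η ∈ C_c^∞(ℝ^d)`. -/
def HasWeakGradient {d : ℕ} (u : EuclideanSpace ℝ (Fin d) → ℝ)
    (g : EuclideanSpace ℝ (Fin d) → EuclideanSpace ℝ (Fin d)) : Prop :=
  LocallyIntegrable u volume ∧ LocallyIntegrable g volume ∧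
    ∀ η : EuclideanSpace ℝ (Fin d) → ℝ, ContDiff ℝ ∞ η → HasCompactSupport η →
      ∀ i : Fin d,
        ∫ x, u x * fderiv ℝ η x (EuclideanSpace.single i 1) = - ∫ x, g x i * η x

/-- Membership in the weighted Sobolev space `H¹(e^θ)`: `u ∈ L²(e^θ)`, and `u` has a weak gradient
in `L²(e^θ)`. -/
def MemH1ExpTheta {d : ℕ} (u : EuclideanSpace ℝ (Fin d) → ℝ) : Prop :=
  MemLp u 2 (expThetaMeasure d) ∧
    ∃ g : EuclideanSpace ℝ (Fin d) → EuclideanSpace ℝ (Fin d),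
      HasWeakGradient u g ∧ MemLp g 2 (expThetaMeasure d)

/-- The exponent `a = 1 + d (1/p - 1/2)`; here `1/∞ = 0`. -/
noncomputable def gnExponent (d : ℕ) (p : ℝ≥0∞) : ℝ :=
  1 + (d : ℝ) * ((p⁻¹).toReal - 1 / 2)

/-- The chain of inequalities
`‖u‖_{L^p(e^θ)} ≤ ‖e^{(1/2-1/p)θ} u‖_{L^p(e^θ)} ≤ C ‖u‖_{L²(e^θ)}^a ‖∇u‖_{L²(e^θ)}^{1-a}`
for all `u ∈ H¹(e^θ)`, with `a = 1 + d (1/p - 1/2)`. The norms take values in `[0, ∞]`. The weak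
gradient `∇u` is unique up to null sets, so any representative `g` of it may be used. -/
def WeightedGagliardoNirenberg (d : ℕ) (p : ℝ≥0∞) (C : ℝ) : Prop :=
  ∀ (u : EuclideanSpace ℝ (Fin d) → ℝ)
    (g : EuclideanSpace ℝ (Fin d) → EuclideanSpace ℝ (Fin d)),
    MemH1ExpTheta u → HasWeakGradient u g →
      eLpNorm u p (expThetaMeasure d) ≤
          eLpNorm (fun x => Real.exp ((1 / 2 - (p⁻¹).toReal) * theta x) * u x) p
            (expThetaMeasure d) ∧
        eLpNorm (fun x => Real.exp ((1 / 2 - (p⁻¹).toReal) * theta x) * u x) p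
            (expThetaMeasure d) ≤
          ENNReal.ofReal C * eLpNorm u 2 (expThetaMeasure d) ^ gnExponent d p *
            eLpNorm g 2 (expThetaMeasure d) ^ (1 - gnExponent d p)

/-!
The substitution `v = e^(θ/2) u` turns the weighted norms into Lebesgue norms: the middle term of
the chain is `‖v‖_p` and `‖u‖_{L²(e^θ)} = ‖v‖₂` (`eLpNorm_exp_theta_mul`), while
`e^(θ/2) ∇u = ∇v - (x/4) v`. Expanding the square and integrating the cross term by parts gives
`∫ |∇v - (x/4) v|² = ∫ |∇v|² + ∫ |x|² v² / 16 + (d/4) ∫ v² ≥ ∫ |∇v|²`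
(`integral_sum_fderiv_sq_le`), so the weighted inequality follows from the Gagliardo–Nirenberg
inequality for Lebesgue measure with the same constant. The first inequality of the chain only says
that `e^((1/2-1/p)θ) ≥ 1`.

The Lebesgue inequality is proved for compactly supported `C¹` functions. In dimension one it comes
from `u² ≤ 2 ‖u‖₂ ‖u'‖₂` (`enorm_sq_le_of_dim_one`). In dimension two Gagliardo's inequality
`∫ w² ≤ ‖∂₁w‖₁ ‖∂₂w‖₁` with `w = u^k` gives the even exponents by induction
(`lintegral_pow_le_of_dim_two`), and Hölder's inequality the exponents between them. In dimension
`n ≥ 3` the constant at the endpoint `2n/(n-2)` is the best constant in the Sobolev inequality, and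
the other exponents follow from the log-convexity of `r ↦ ∫ |u|^r`.

The sharp Sobolev inequality (`sharp_sobolev_mass`) is proved by mass transport, as by
Cordero-Erausquin, Nazaret and Villani, with Knothe's triangular map in place of Brenier's map. Let
`T` carry the density `f = |u|^(2n/(n-2))` to a multiple `c (1 + |y|²)^(-n)` of the extremal profile
of the same mass, with diagonal derivatives `Dᵢ = ∂ᵢTᵢ > 0` and `∏ Dᵢ = f / (c (1 + |T|²)^(-n))`.
The arithmetic–geometric mean inequality bounds `f (1 + |T|²)` by a constant times
`|u|^(2(n-1)/(n-2)) ∑ Dᵢ`; integration by parts, Young's inequality and the transport property bound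
the integral of the latter by `‖∇u‖₂²` and second moments of the profile. For `u` a rescaled profile
to the power `(n-2)/(2n)` the map `T` is a homothety and each step is an equality, so the constant
is sharp. The mass of the profile is a quotient of Gamma values (`lintegral_bracketSq_rpow_neg`).
Only the diagonal derivatives of `T` are used, and these exist for the Knothe map built by induction
on the dimension (`exists_knothe_map`); `f` is made positive by adding a small multiple `δ` of the
profile, and `δ → 0` at the end.

The passage to `H¹(e^θ)` is by cutoff and mollification. As Fatou's lemma handles the left-hand
side, it is enough to bound the two norms on the right in the limit from above, and no density
theorem in the weighted space is required (`eLpNorm_le_of_tendsto_ae`).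
-/

/-! ### Knothe's triangular transport map -/

open Filter Topology Set in
/-- A strictly increasing continuous family `V y` of distribution functions with values `(0, 1)` can
be inverted continuously: `V (y z) (S z) = c z` has a solution `S` continuous in `z`. -/
theorem exists_continuous_inverse_of_strictMono {Y Z : Type*} [TopologicalSpace Y]
    [TopologicalSpace Z] {V : Y → ℝ → ℝ} (hV : Continuous fun p : Y × ℝ => V p.1 p.2)
    (hmono : ∀ y, StrictMono (V y)) (hsurj : ∀ y, ∀ c ∈ Ioo (0 : ℝ) 1, ∃ s, V y s = c)
    {y : Z → Y} (hy : Continuous y) {c : Z → ℝ} (hc : Continuous c)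
    (hc' : ∀ z, c z ∈ Ioo (0 : ℝ) 1) :
    ∃ S : Z → ℝ, Continuous S ∧ ∀ z, V (y z) (S z) = c z := by
  choose S hS using fun z => hsurj (y z) (c z) (hc' z)
  refine ⟨S, ?_, hS⟩
  rw [continuous_iff_continuousAt]
  intro z₀
  have hV' : ∀ s, Continuous fun z => V (y z) s := fun s =>
    hV.comp (hy.prodMk continuous_const)
  refine (tendsto_order.2 ⟨fun a ha => ?_, fun a ha => ?_⟩ : Tendsto S (𝓝 z₀) (𝓝 (S z₀)))
  · have h0 : V (y z₀) a < c z₀ := by rw [← hS z₀]; exact hmono _ ha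
    filter_upwards [((hV' a).tendsto z₀).eventually_lt (hc.tendsto z₀) h0] with z hz
    rw [← hS z] at hz
    exact (hmono _).lt_iff_lt.1 hz
  · have h0 : c z₀ < V (y z₀) a := by rw [← hS z₀]; exact hmono _ ha
    filter_upwards [(hc.tendsto z₀).eventually_lt ((hV' a).tendsto z₀) h0] with z hz
    rw [← hS z] at hz
    exact (hmono _).lt_iff_lt.1 hz

/-- Positive continuous functions on `ℝⁿ` with the product decay `∏ (1 + xᵢ²)⁻¹`. The class is
stable under integrating out a coordinate, which is what the construction of the Knothe map by
induction on the dimension needs. -/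
structure IsDecayingDensity {n : ℕ} (F : (Fin n → ℝ) → ℝ) : Prop where
  continuous : Continuous F
  pos : ∀ x, 0 < F x
  bound : ∃ C : ℝ, ∀ x, F x ≤ C * ∏ i, (1 + x i ^ 2)⁻¹

/-- The density obtained by integrating out the coordinate `0`. -/
noncomputable def tailMarginal {n : ℕ} (F : (Fin (n + 1) → ℝ) → ℝ) (x : Fin n → ℝ) : ℝ :=
  ∫ t, F (Fin.cons t x)

/-- The distribution function of the coordinate `0` conditioned on the other coordinates. -/
noncomputable def headCDF {n : ℕ} (F : (Fin (n + 1) → ℝ) → ℝ) (x : Fin n → ℝ) (t : ℝ) : ℝ :=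
  (∫ s in Set.Iic t, F (Fin.cons s x)) / tailMarginal F x

theorem continuous_finCons {n : ℕ} :
    Continuous fun p : (Fin n → ℝ) × ℝ => (Fin.cons p.2 p.1 : Fin (n + 1) → ℝ) :=
  Continuous.finCons continuous_snd continuous_fst

/-- Tonelli's theorem with the coordinate `0` as inner variable. -/
theorem lintegral_finCons {n : ℕ} {f : (Fin (n + 1) → ℝ) → ℝ≥0∞} (hf : Measurable f) :
    ∫⁻ x, f x = ∫⁻ x : Fin n → ℝ, ∫⁻ t : ℝ, f (Fin.cons t x) := by
  have e := (volume_preserving_piFinSuccAbove (fun _ : Fin (n + 1) => ℝ) 0).symm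
  rw [← e.lintegral_comp hf, Measure.volume_eq_prod, lintegral_prod_symm]
  · simp [MeasurableEquiv.piFinSuccAbove, Fin.insertNthEquiv]
  · exact (hf.comp (MeasurableEquiv.measurable _)).aemeasurable

namespace IsDecayingDensity

variable {n : ℕ}

theorem exists_bound_nonneg {F : (Fin n → ℝ) → ℝ} (hF : IsDecayingDensity F) :
    ∃ C : ℝ, 0 ≤ C ∧ ∀ x, F x ≤ C * ∏ i, (1 + x i ^ 2)⁻¹ := by
  obtain ⟨C, hC⟩ := hF.bound
  refine ⟨C, ?_, hC⟩
  by_contra! h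
  have h1 := (hF.pos 0).trans_le (hC 0)
  simp at h1
  linarith

variable {F : (Fin (n + 1) → ℝ) → ℝ}

theorem slice_bound (hF : IsDecayingDensity F) :
    ∃ C : ℝ, 0 ≤ C ∧ (∀ x t, F (Fin.cons t x) ≤ C * (∏ i, (1 + x i ^ 2)⁻¹) * (1 + t ^ 2)⁻¹) ∧
      ∀ x t, F (Fin.cons t x) ≤ C * (1 + t ^ 2)⁻¹ := by
  obtain ⟨C, hC0, hC⟩ := hF.exists_bound_nonneg
  have h1 : ∀ x t, F (Fin.cons t x) ≤ C * (∏ i, (1 + x i ^ 2)⁻¹) * (1 + t ^ 2)⁻¹ := by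
    intro x t
    refine (hC _).trans_eq ?_
    rw [Fin.prod_univ_succ]
    simp only [Fin.cons_zero, Fin.cons_succ]
    ring
  refine ⟨C, hC0, h1, fun x t => (h1 x t).trans ?_⟩
  have h2 : ∏ i, (1 + x i ^ 2)⁻¹ ≤ (1 : ℝ) :=
    Finset.prod_le_one (fun i _ => by positivity)
      fun i _ => inv_le_one_of_one_le₀ (by nlinarith [sq_nonneg (x i)])
  have h3 : 0 ≤ (1 + t ^ 2)⁻¹ := by positivity
  exact mul_le_mul_of_nonneg_right (mul_le_of_le_one_right hC0 h2) h3

theorem continuous_slice (hF : IsDecayingDensity F) (x : Fin n → ℝ) :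
    Continuous fun t : ℝ => F (Fin.cons t x) :=
  hF.continuous.comp (continuous_finCons.comp (continuous_const.prodMk continuous_id))

theorem integrable_slice (hF : IsDecayingDensity F) (x : Fin n → ℝ) :
    Integrable fun t : ℝ => F (Fin.cons t x) := by
  obtain ⟨C, -, -, hC⟩ := hF.slice_bound
  refine (integrable_inv_one_add_sq.const_mul C).mono'
    (hF.continuous_slice x).aestronglyMeasurable (ae_of_all _ fun t => ?_)
  rw [Real.norm_of_nonneg (hF.pos _).le]
  exact hC x t

theorem tailMarginal_pos (hF : IsDecayingDensity F) (x : Fin n → ℝ) : 0 < tailMarginal F x :=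
  integral_pos_of_integrable_nonneg_nonzero (x := 0) (hF.continuous_slice x) (hF.integrable_slice x)
    (fun _ => (hF.pos _).le) (hF.pos _).ne'

theorem tailMarginal (hF : IsDecayingDensity F) : IsDecayingDensity (tailMarginal F) := by
  obtain ⟨C, hC0, hC1, hC⟩ := hF.slice_bound
  refine ⟨?_, hF.tailMarginal_pos, C * Real.pi, fun x => ?_⟩
  · refine continuous_of_dominated (bound := fun t => C * (1 + t ^ 2)⁻¹)
      (fun x => (hF.continuous_slice x).aestronglyMeasurable)
      (fun x => ae_of_all _ fun t => ?_) (integrable_inv_one_add_sq.const_mul C)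
      (ae_of_all _ fun t => ?_)
    · rw [Real.norm_of_nonneg (hF.pos _).le]
      exact hC x t
    · exact hF.continuous.comp (continuous_finCons.comp (continuous_id.prodMk continuous_const))
  · calc ∫ t, F (Fin.cons t x) ≤ ∫ t : ℝ, C * (∏ i, (1 + x i ^ 2)⁻¹) * (1 + t ^ 2)⁻¹ :=
          integral_mono (hF.integrable_slice x) (integrable_inv_one_add_sq.const_mul _) (hC1 x)
      _ = C * Real.pi * ∏ i, (1 + x i ^ 2)⁻¹ := by
          rw [integral_const_mul, integral_univ_inv_one_add_sq]; ring

theorem ofReal_tailMarginal (hF : IsDecayingDensity F) (x : Fin n → ℝ) :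
    ENNReal.ofReal (_root_.tailMarginal F x) = ∫⁻ t, ENNReal.ofReal (F (Fin.cons t x)) :=
  ofReal_integral_eq_lintegral_ofReal (hF.integrable_slice x) (ae_of_all _ fun _ => (hF.pos _).le)

theorem lintegral_tailMarginal (hF : IsDecayingDensity F) :
    ∫⁻ x, ENNReal.ofReal (_root_.tailMarginal F x) = ∫⁻ x, ENNReal.ofReal (F x) := by
  rw [lintegral_finCons hF.continuous.measurable.ennreal_ofReal]
  exact lintegral_congr hF.ofReal_tailMarginal

theorem integral_Iic_eq (hF : IsDecayingDensity F) (x : Fin n → ℝ) (t : ℝ) :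
    ∫ s in Set.Iic t, F (Fin.cons s x) =
      (∫ s in Set.Iic 0, F (Fin.cons s x)) + ∫ s in (0 : ℝ)..t, F (Fin.cons s x) := by
  rw [← intervalIntegral.integral_Iic_sub_Iic (hF.integrable_slice x).integrableOn
    (hF.integrable_slice x).integrableOn]
  ring

theorem continuous_headCDF (hF : IsDecayingDensity F) :
    Continuous fun p : (Fin n → ℝ) × ℝ => headCDF F p.1 p.2 := by
  unfold headCDF
  refine Continuous.div ?_ (hF.tailMarginal.continuous.comp continuous_fst)
    fun p => (hF.tailMarginal_pos _).ne'
  refine Continuous.congr (Continuous.add ?_ ?_) fun p => (hF.integral_Iic_eq p.1 p.2).symm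
  · obtain ⟨C, hC0, hC1, hC⟩ := hF.slice_bound
    refine continuous_of_dominated (bound := fun t => C * (1 + t ^ 2)⁻¹)
      (fun x => (hF.continuous_slice _).aestronglyMeasurable)
      (fun x => ae_of_all _ fun t => ?_) (integrable_inv_one_add_sq.const_mul C).restrict
      (ae_of_all _ fun t => ?_)
    · rw [Real.norm_of_nonneg (hF.pos _).le]
      exact hC _ t
    · exact hF.continuous.comp (continuous_finCons.comp (continuous_fst.prodMk continuous_const))
  · refine intervalIntegral.continuous_parametric_intervalIntegral_of_continuous ?_ continuous_snd
    exact hF.continuous.comp (continuous_finCons.comp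
      ((continuous_fst.comp continuous_fst).prodMk continuous_snd))

theorem hasDerivAt_headCDF (hF : IsDecayingDensity F) (x : Fin n → ℝ) (t : ℝ) :
    HasDerivAt (headCDF F x) (F (Fin.cons t x) / _root_.tailMarginal F x) t := by
  unfold headCDF
  refine HasDerivAt.div_const ?_ _
  rw [funext (hF.integral_Iic_eq x)]
  refine HasDerivAt.const_add _ ?_
  exact intervalIntegral.integral_hasDerivAt_right
    ((hF.continuous_slice x).intervalIntegrable _ _)
    (hF.continuous_slice x).stronglyMeasurable.stronglyMeasurableAtFilter
    (hF.continuous_slice x).continuousAt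

theorem strictMono_headCDF (hF : IsDecayingDensity F) (x : Fin n → ℝ) : StrictMono (headCDF F x) :=
  strictMono_of_hasDerivAt_pos (hF.hasDerivAt_headCDF x)
    fun _ => div_pos (hF.pos _) (hF.tailMarginal_pos x)

open Filter Topology in
theorem tendsto_headCDF_atBot (F : (Fin (n + 1) → ℝ) → ℝ) (x : Fin n → ℝ) :
    Tendsto (headCDF F x) atBot (𝓝 0) := by
  have h := (tendsto_integral_Iic_zero (f := fun s => F (Fin.cons s x)) (μ := volume)
    (tendsto_id (α := ℝ) (x := atBot))).div_const (_root_.tailMarginal F x)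
  rwa [zero_div] at h

open Filter Topology in
theorem tendsto_headCDF_atTop (hF : IsDecayingDensity F) (x : Fin n → ℝ) :
    Tendsto (headCDF F x) atTop (𝓝 1) := by
  have h1 : Tendsto (fun t : ℝ => ∫ s in Set.Iic t, F (Fin.cons s x)) atTop
      (𝓝 (_root_.tailMarginal F x)) :=
    (aecover_Iic tendsto_id).integral_tendsto_of_countably_generated (hF.integrable_slice x)
  have h := h1.div_const (_root_.tailMarginal F x)
  rwa [div_self (hF.tailMarginal_pos x).ne'] at h

theorem headCDF_mem_Ioo (hF : IsDecayingDensity F) (x : Fin n → ℝ) (t : ℝ) :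
    headCDF F x t ∈ Set.Ioo (0 : ℝ) 1 := by
  have hm := hF.strictMono_headCDF x
  constructor
  · exact (hm.monotone.le_of_tendsto (tendsto_headCDF_atBot F x) (t - 1)).trans_lt
      (hm (by linarith))
  · exact (hm (by linarith : t < t + 1)).trans_le
      (hm.monotone.ge_of_tendsto (hF.tendsto_headCDF_atTop x) (t + 1))

theorem exists_headCDF_eq (hF : IsDecayingDensity F) (x : Fin n → ℝ) {c : ℝ}
    (hc : c ∈ Set.Ioo (0 : ℝ) 1) : ∃ t, headCDF F x t = c := by
  have hcont : Continuous (headCDF F x) :=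
    hF.continuous_headCDF.comp (continuous_const.prodMk continuous_id)
  exact mem_range_of_exists_le_of_exists_ge hcont
    (((tendsto_headCDF_atBot F x).eventually_le_const hc.1).exists)
    (((hF.tendsto_headCDF_atTop x).eventually_const_le hc.2).exists)

end IsDecayingDensity

/-- One step of the Knothe construction: given a continuous map `τ` of the remaining coordinates,
the coordinate `0` is rearranged by a monotone map `S (x, ·)` matching the conditional distribution
functions of `F` at `x` and of `G` at `τ x`. -/
theorem exists_conditional_monotone_transport {n : ℕ} {F G : (Fin (n + 1) → ℝ) → ℝ}
    (hF : IsDecayingDensity F) (hG : IsDecayingDensity G) {τ : (Fin n → ℝ) → Fin n → ℝ}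
    (hτ : Continuous τ) :
    ∃ S D : (Fin n → ℝ) → ℝ → ℝ, Continuous (fun p : (Fin n → ℝ) × ℝ => S p.1 p.2) ∧
      Continuous (fun p : (Fin n → ℝ) × ℝ => D p.1 p.2) ∧
      (∀ x t, HasDerivAt (S x) (D x t) t) ∧ (∀ x t, 0 < D x t) ∧
      (∀ x t, D x t * (G (Fin.cons (S x t) (τ x)) / tailMarginal G (τ x)) =
        F (Fin.cons t x) / tailMarginal F x) ∧
      ∀ x, Function.Bijective (S x) := by
  obtain ⟨S, hSc, hS⟩ := exists_continuous_inverse_of_strictMono (Z := (Fin n → ℝ) × ℝ)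
    hG.continuous_headCDF hG.strictMono_headCDF (fun y c hc => hG.exists_headCDF_eq y hc)
    (hτ.comp continuous_fst) hF.continuous_headCDF fun p => hF.headCDF_mem_Ioo p.1 p.2
  have hGp : ∀ x t, 0 < G (Fin.cons (S (x, t)) (τ x)) / tailMarginal G (τ x) := fun x t =>
    div_pos (hG.pos _) (hG.tailMarginal_pos _)
  have hFp : ∀ x t, 0 < F (Fin.cons t x) / tailMarginal F x := fun x t =>
    div_pos (hF.pos _) (hF.tailMarginal_pos _)
  refine ⟨fun x t => S (x, t), fun x t => (F (Fin.cons t x) / tailMarginal F x) /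
    (G (Fin.cons (S (x, t)) (τ x)) / tailMarginal G (τ x)), hSc, ?_, ?_, ?_, ?_, ?_⟩
  · refine Continuous.div (Continuous.div (hF.continuous.comp continuous_finCons)
      (hF.tailMarginal.continuous.comp continuous_fst) fun p => (hF.tailMarginal_pos _).ne')
      (Continuous.div (hG.continuous.comp (continuous_finCons.comp
        ((hτ.comp continuous_fst).prodMk hSc)))
      (hG.tailMarginal.continuous.comp (hτ.comp continuous_fst))
        fun p => (hG.tailMarginal_pos _).ne') fun p => (hGp _ _).ne'
  · intro x t
    -- `S x` is the inverse of the order isomorphism `headCDF G (τ x)` composed with `headCDF F x`.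
    have h1 := hG.hasDerivAt_headCDF (τ x) (S (x, t))
    have h2 := hF.hasDerivAt_headCDF x t
    have hcS : Continuous fun s => S (x, s) := hSc.comp (continuous_const.prodMk continuous_id)
    rw [hasDerivAt_iff_tendsto_slope] at h1 h2 ⊢
    have hinj : ∀ s, s ≠ t → S (x, s) ≠ S (x, t) := by
      intro s hs he
      apply hs
      apply (hF.strictMono_headCDF x).injective
      have e1 := hS (x, s)
      have e2 := hS (x, t)
      simp only [Function.comp] at e1 e2
      rw [← e1, ← e2, he]
    have h3 : Filter.Tendsto (fun s => S (x, s)) (nhdsWithin t {t}ᶜ)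
        (nhdsWithin (S (x, t)) {S (x, t)}ᶜ) :=
      tendsto_nhdsWithin_of_tendsto_nhds_of_eventually_within _
        (hcS.continuousAt.tendsto.mono_left nhdsWithin_le_nhds)
        (eventually_nhdsWithin_of_forall fun s hs => hinj s hs)
    refine (h2.div (h1.comp h3) (hGp x t).ne').congr' ?_
    filter_upwards [self_mem_nhdsWithin] with s hs
    have e1 := hS (x, s)
    have e2 := hS (x, t)
    simp only [Function.comp] at e1 e2
    simp only [Function.comp, slope_def_field, Pi.div_apply, e1, e2]
    have hne : headCDF F x s - headCDF F x t ≠ 0 :=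
      sub_ne_zero.2 fun h => hs ((hF.strictMono_headCDF x).injective h)
    have hne1 := sub_ne_zero.2 (hinj s hs)
    have hne2 : s - t ≠ 0 := sub_ne_zero.2 hs
    field_simp
  · exact fun x t => div_pos (hFp x t) (hGp x t)
  · exact fun x t => div_mul_cancel₀ _ (hGp x t).ne'
  · refine fun x => ⟨fun s t h => ?_, fun s => ?_⟩
    · apply (hF.strictMono_headCDF x).injective
      have e1 := hS (x, s)
      have e2 := hS (x, t)
      simp only [Function.comp] at e1 e2 h
      rw [← e1, ← e2, h]
    · obtain ⟨t, ht⟩ := hF.exists_headCDF_eq x (hG.headCDF_mem_Ioo (τ x) s)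
      refine ⟨t, (hG.strictMono_headCDF (τ x)).injective ?_⟩
      rw [← ht]
      exact hS (x, t)

/-- **Knothe map.** Two densities of equal mass are related by a continuous map `T` whose `i`-th
component is differentiable and increasing in the variable `xᵢ`, with derivative `D x i`, such that
the product of these derivatives (the Jacobian of the triangular map `T`) is `F / (G ∘ T)`, and
such that `T` transports `F` to `G`. Only the diagonal derivatives of `T` are asserted to exist. -/
theorem exists_knothe_map (n : ℕ) {F G : (Fin n → ℝ) → ℝ}
    (hF : IsDecayingDensity F) (hG : IsDecayingDensity G)
    (hFG : ∫⁻ x, ENNReal.ofReal (F x) = ∫⁻ x, ENNReal.ofReal (G x)) :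
    ∃ T D : (Fin n → ℝ) → Fin n → ℝ, Continuous T ∧ Continuous D ∧
      (∀ x i, HasDerivAt (fun s => T (Function.update x i s) i) (D x i) (x i)) ∧
      (∀ x i, 0 < D x i) ∧ (∀ x, (∏ i, D x i) * G (T x) = F x) ∧
      ∀ w : (Fin n → ℝ) → ℝ≥0∞, Measurable w →
        ∫⁻ x, w (T x) * ENNReal.ofReal (F x) = ∫⁻ y, w y * ENNReal.ofReal (G y) := by
  induction n with
  | zero =>
    have h0 : ∀ x : Fin 0 → ℝ, F x = G x := by
      intro x
      rw [volume_pi, Measure.pi_of_empty _ x] at hFG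
      rw [lintegral_dirac, lintegral_dirac] at hFG
      exact (ENNReal.ofReal_eq_ofReal_iff (hF.pos _).le (hG.pos _).le).1 hFG
    refine ⟨id, fun x i => i.elim0, continuous_id, continuous_const.congr fun x =>
      (funext fun i => i.elim0 : (fun _ => (0 : ℝ)) = _), fun x i => i.elim0, fun x i => i.elim0,
      fun x => ?_, fun w _ => ?_⟩
    · simp [h0]
    · simp [h0]
  | succ n ih =>
    obtain ⟨T, D, hT, hD, hTD, hDp, hJ, hpush⟩ := ih hF.tailMarginal hG.tailMarginal
      (by rw [hF.lintegral_tailMarginal, hG.lintegral_tailMarginal, hFG])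
    obtain ⟨S, E, hS, hE, hSE, hEp, hEJ, hbij⟩ := exists_conditional_monotone_transport hF hG hT
    have htail : Continuous fun x : Fin (n + 1) → ℝ => Fin.tail x :=
      continuous_pi fun i => continuous_apply _
    have hsplit : Continuous fun x : Fin (n + 1) → ℝ => (Fin.tail x, x 0) :=
      htail.prodMk (continuous_apply 0)
    refine ⟨fun x => Fin.cons (S (Fin.tail x) (x 0)) (T (Fin.tail x)),
      fun x => Fin.cons (E (Fin.tail x) (x 0)) (D (Fin.tail x)), ?_, ?_, ?_, ?_, ?_, ?_⟩
    · exact (hS.comp hsplit).finCons (hT.comp htail)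
    · exact (hE.comp hsplit).finCons (hD.comp htail)
    · intro x i
      refine Fin.cases ?_ (fun j => ?_) i
      · simp only [Fin.cons_zero, Fin.tail_update_zero, Function.update_self]
        exact hSE _ _
      · simp only [Fin.cons_succ, Fin.tail_update_succ]
        exact hTD (Fin.tail x) j
    · intro x i
      refine Fin.cases ?_ (fun j => ?_) i
      · exact hEp _ _
      · exact hDp _ _
    · intro x
      have h1 := hEJ (Fin.tail x) (x 0)
      have h2 := hJ (Fin.tail x)
      rw [Fin.cons_self_tail] at h1
      have hGp := hG.tailMarginal_pos (T (Fin.tail x))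
      have hFp := hF.tailMarginal_pos (Fin.tail x)
      rw [Fin.prod_univ_succ]
      simp only [Fin.cons_zero, Fin.cons_succ]
      rw [← mul_div_assoc, div_eq_div_iff hGp.ne' hFp.ne', ← h2, ← mul_assoc] at h1
      apply mul_right_cancel₀ hGp.ne'
      linear_combination h1
    · intro w hw
      have hcons : ∀ x : Fin n → ℝ, Measurable fun t : ℝ => (Fin.cons t x : Fin (n + 1) → ℝ) :=
        fun x => (continuous_finCons.comp (continuous_const.prodMk continuous_id)).measurable
      have hcons' := (continuous_finCons (n := n)).measurable
      rw [lintegral_finCons, lintegral_finCons]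
      rotate_left
      · exact hw.mul hG.continuous.measurable.ennreal_ofReal
      · refine Measurable.mul (hw.comp ?_) hF.continuous.measurable.ennreal_ofReal
        exact ((hS.comp hsplit).finCons (hT.comp htail)).measurable
      simp only [Fin.tail_cons, Fin.cons_zero]
      -- the integral of `w` against the conditional density of `G` given the tail
      set W : (Fin n → ℝ) → ℝ≥0∞ := fun y =>
        ∫⁻ s, w (Fin.cons s y) * ENNReal.ofReal (G (Fin.cons s y) / tailMarginal G y) with hW
      have hWm : Measurable W := by
        refine Measurable.lintegral_prod_right' (f := fun p : (Fin n → ℝ) × ℝ =>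
          w (Fin.cons p.2 p.1) * ENNReal.ofReal (G (Fin.cons p.2 p.1) / tailMarginal G p.1)) ?_
        exact (hw.comp hcons').mul ((hG.continuous.measurable.comp hcons').div
          (hG.tailMarginal.continuous.measurable.comp measurable_fst)).ennreal_ofReal
      have key : ∀ x, ∫⁻ t, w (Fin.cons (S x t) (T x)) * ENNReal.ofReal (F (Fin.cons t x)) =
          W (T x) * ENNReal.ofReal (tailMarginal F x) := by
        intro x
        have hch := lintegral_image_eq_lintegral_abs_deriv_mul (f := S x) (f' := E x)
          MeasurableSet.univ (fun t _ => (hSE x t).hasDerivWithinAt) (hbij x).injective.injOn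
          (fun s => w (Fin.cons s (T x)) *
            ENNReal.ofReal (G (Fin.cons s (T x)) / tailMarginal G (T x)))
        rw [Set.image_univ, (hbij x).surjective.range_eq, setLIntegral_univ, setLIntegral_univ]
          at hch
        rw [hW]
        simp only
        rw [hch, ← lintegral_mul_const']
        · refine lintegral_congr fun t => ?_
          have h1 := hEJ x t
          have hFp := hF.tailMarginal_pos x
          have h2 : F (Fin.cons t x) = E x t *
              (G (Fin.cons (S x t) (T x)) / tailMarginal G (T x)) * tailMarginal F x := by
            rw [h1]; field_simp
          rw [h2, ENNReal.ofReal_mul (mul_nonneg (hEp x t).le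
            (div_pos (hG.pos _) (hG.tailMarginal_pos _)).le), ENNReal.ofReal_mul (hEp x t).le,
            abs_of_pos (hEp x t)]
          ring
        · exact ENNReal.ofReal_ne_top
      simp_rw [key]
      rw [hpush W hWm]
      refine lintegral_congr fun y => ?_
      rw [hW]
      simp only
      rw [← lintegral_mul_const' _ _ ENNReal.ofReal_ne_top]
      refine lintegral_congr fun s => ?_
      have hGp := hG.tailMarginal_pos y
      rw [mul_assoc, ← ENNReal.ofReal_mul (div_pos (hG.pos _) hGp).le, div_mul_cancel₀ _ hGp.ne']

/-! ### The extremal profile `(1 + |x|²)^(-n)` -/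

/-- The weight `1 + |x|²` on `ℝⁿ`, with `|x|` the Euclidean length. -/
def bracketSq {n : ℕ} (x : Fin n → ℝ) : ℝ := 1 + ∑ i, x i ^ 2

section bracketSq

variable {n : ℕ}

theorem one_le_bracketSq (x : Fin n → ℝ) : 1 ≤ bracketSq x :=
  le_add_of_nonneg_right (Finset.sum_nonneg fun i _ => sq_nonneg (x i))

theorem bracketSq_pos (x : Fin n → ℝ) : 0 < bracketSq x := one_pos.trans_le (one_le_bracketSq x)

theorem continuous_bracketSq : Continuous (bracketSq (n := n)) := by
  unfold bracketSq; fun_prop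

theorem lintegral_exp_neg_mul_bracketSq {t : ℝ} (ht : 0 < t) :
    ∫⁻ x : Fin n → ℝ, ENNReal.ofReal (Real.exp (-(bracketSq x * t))) =
      ENNReal.ofReal (Real.exp (-t) * (Real.pi / t) ^ ((n : ℝ) / 2)) := by
  have h1 : ∀ x : Fin n → ℝ, Real.exp (-(bracketSq x * t)) =
      Real.exp (-t) * ∏ i, Real.exp (-t * x i ^ 2) := by
    intro x
    rw [← Real.exp_sum, ← Real.exp_add, bracketSq, ← Finset.mul_sum]
    ring_nf
  have hi : Integrable fun x : Fin n → ℝ => ∏ i, Real.exp (-t * x i ^ 2) :=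
    Integrable.fintype_prod (f := fun _ s => Real.exp (-t * s ^ 2))
      fun _ => integrable_exp_neg_mul_sq ht
  simp_rw [h1]
  rw [← ofReal_integral_eq_lintegral_ofReal (hi.const_mul _) (ae_of_all _ fun x => by positivity),
    integral_const_mul, integral_fintype_prod_volume_eq_pow (fun s : ℝ => Real.exp (-t * s ^ 2)),
    integral_gaussian, Fintype.card_fin, Real.sqrt_eq_rpow, ← Real.rpow_natCast,
    ← Real.rpow_mul (by positivity)]
  ring_nf

theorem lintegral_rpow_mul_exp_neg_mul {a r : ℝ} (ha : 0 < a) (hr : 0 < r) :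
    ∫⁻ t in Set.Ioi (0 : ℝ), ENNReal.ofReal (t ^ (a - 1) * Real.exp (-(r * t))) =
      ENNReal.ofReal ((1 / r) ^ a * Real.Gamma a) := by
  have h := Real.integral_rpow_mul_exp_neg_mul_Ioi ha hr
  have hpos : 0 < (1 / r) ^ a * Real.Gamma a := mul_pos (by positivity) (Real.Gamma_pos_of_pos ha)
  rw [← h, ofReal_integral_eq_lintegral_ofReal]
  · by_contra hc
    rw [integral_undef hc] at h
    exact hpos.ne h
  · filter_upwards [ae_restrict_mem measurableSet_Ioi] with t ht
    have : (0 : ℝ) < t := ht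
    positivity

/-- The mass of the extremal profile, by writing `(1 + |x|²)^(-s)` as a mixture of Gaussians. -/
theorem lintegral_bracketSq_rpow_neg {s : ℝ} (hs : (n : ℝ) / 2 < s) :
    ∫⁻ x : Fin n → ℝ, ENNReal.ofReal (bracketSq x ^ (-s)) =
      ENNReal.ofReal (Real.pi ^ ((n : ℝ) / 2) * Real.Gamma (s - n / 2) / Real.Gamma s) := by
  have hs0 : 0 < s := lt_of_le_of_lt (by positivity) hs
  have hΓ := Real.Gamma_pos_of_pos hs0
  have h1 : ∀ x : Fin n → ℝ, ENNReal.ofReal (bracketSq x ^ (-s)) =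
      ENNReal.ofReal (Real.Gamma s)⁻¹ * ∫⁻ t in Set.Ioi (0 : ℝ),
        ENNReal.ofReal (t ^ (s - 1) * Real.exp (-(bracketSq x * t))) := by
    intro x
    rw [lintegral_rpow_mul_exp_neg_mul hs0 (bracketSq_pos x), ← ENNReal.ofReal_mul (by positivity)]
    congr 1
    rw [one_div, Real.inv_rpow (bracketSq_pos x).le, Real.rpow_neg (bracketSq_pos x).le]
    field_simp
  simp_rw [h1]
  rw [lintegral_const_mul' _ _ ENNReal.ofReal_ne_top, lintegral_lintegral_swap]
  · have h2 : ∫⁻ t in Set.Ioi (0 : ℝ), ∫⁻ x : Fin n → ℝ,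
        ENNReal.ofReal (t ^ (s - 1) * Real.exp (-(bracketSq x * t))) =
        ∫⁻ t in Set.Ioi (0 : ℝ), ENNReal.ofReal (Real.pi ^ ((n : ℝ) / 2)) *
          ENNReal.ofReal (t ^ (s - n / 2 - 1) * Real.exp (-(1 * t))) := by
      refine setLIntegral_congr_fun measurableSet_Ioi fun t ht => ?_
      have ht' : (0 : ℝ) < t := ht
      simp_rw [ENNReal.ofReal_mul (Real.rpow_nonneg ht'.le (s - 1))]
      rw [lintegral_const_mul' _ _ ENNReal.ofReal_ne_top, lintegral_exp_neg_mul_bracketSq ht',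
        ← ENNReal.ofReal_mul (by positivity), ← ENNReal.ofReal_mul (by positivity),
        Real.div_rpow Real.pi_pos.le ht'.le, one_mul]
      congr 1
      rw [show s - n / 2 - 1 = (s - 1) - n / 2 by ring, Real.rpow_sub ht' (s - 1)]
      ring
    rw [h2, lintegral_const_mul' _ _ ENNReal.ofReal_ne_top,
      lintegral_rpow_mul_exp_neg_mul (by linarith) one_pos, ← ENNReal.ofReal_mul (by positivity),
      ← ENNReal.ofReal_mul (by positivity)]
    congr 1
    simp
    ring
  · have : Measurable fun p : (Fin n → ℝ) × ℝ =>
        p.2 ^ (s - 1) * Real.exp (-(bracketSq p.1 * p.2)) := by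
      have := (continuous_bracketSq (n := n)).measurable
      fun_prop
    exact this.ennreal_ofReal.aemeasurable

theorem integrable_bracketSq_rpow_neg {s : ℝ} (hs : (n : ℝ) / 2 < s) :
    Integrable fun x : Fin n → ℝ => bracketSq x ^ (-s) := by
  refine ⟨(continuous_bracketSq.rpow_const fun x =>
    Or.inl (bracketSq_pos x).ne').aestronglyMeasurable, ?_⟩
  rw [hasFiniteIntegral_iff_ofReal (ae_of_all _ fun x => Real.rpow_nonneg (bracketSq_pos x).le _),
    lintegral_bracketSq_rpow_neg hs]
  exact ENNReal.ofReal_lt_top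

theorem integral_bracketSq_rpow_neg {s : ℝ} (hs : (n : ℝ) / 2 < s) :
    ∫ x : Fin n → ℝ, bracketSq x ^ (-s) =
      Real.pi ^ ((n : ℝ) / 2) * Real.Gamma (s - n / 2) / Real.Gamma s := by
  have hs0 : 0 < s := lt_of_le_of_lt (by positivity) hs
  have h1 := Real.Gamma_pos_of_pos hs0
  have h2 : 0 < Real.Gamma (s - n / 2) := Real.Gamma_pos_of_pos (by linarith)
  rw [integral_eq_lintegral_of_nonneg_ae (ae_of_all _ fun x =>
    Real.rpow_nonneg (bracketSq_pos x).le _) (integrable_bracketSq_rpow_neg hs).1,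
    lintegral_bracketSq_rpow_neg hs, ENNReal.toReal_ofReal (by positivity)]

theorem prod_one_add_sq_le_bracketSq_pow (x : Fin n → ℝ) :
    ∏ i, (1 + x i ^ 2) ≤ bracketSq x ^ n := by
  calc ∏ i, (1 + x i ^ 2) ≤ ∏ _i : Fin n, bracketSq x :=
        Finset.prod_le_prod (fun i _ => by positivity) fun i _ => by
          have := Finset.single_le_sum (f := fun j => x j ^ 2) (fun j _ => sq_nonneg (x j))
            (Finset.mem_univ i)
          unfold bracketSq
          linarith
    _ = bracketSq x ^ n := by simp

/-- The densities used for the Knothe map: a compactly supported function plus a positive multiple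
of the extremal profile, which makes it positive. -/
theorem isDecayingDensity_add_bracketSq {f : (Fin n → ℝ) → ℝ} (hf : Continuous f)
    (hf0 : ∀ x, 0 ≤ f x) (hfc : HasCompactSupport f) {c : ℝ} (hc : 0 < c) :
    IsDecayingDensity fun x => f x + c * bracketSq x ^ (-(n : ℝ)) := by
  have hcont : Continuous fun x : Fin n → ℝ => bracketSq x ^ (-(n : ℝ)) :=
    continuous_bracketSq.rpow_const fun x => Or.inl (bracketSq_pos x).ne'
  refine ⟨hf.add (continuous_const.mul hcont), fun x =>
    add_pos_of_nonneg_of_pos (hf0 x) (mul_pos hc (Real.rpow_pos_of_pos (bracketSq_pos x) _)), ?_⟩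
  obtain ⟨C, hC⟩ := (hfc.mul_right (f' := fun x => ∏ i, (1 + x i ^ 2))).exists_bound_of_continuous
    (hf.mul (by fun_prop))
  refine ⟨C + c, fun x => ?_⟩
  have hp : 0 < ∏ i, (1 + x i ^ 2) := Finset.prod_pos fun i _ => by positivity
  have h1 : f x ≤ C * (∏ i, (1 + x i ^ 2))⁻¹ := by
    rw [← div_eq_mul_inv, le_div_iff₀ hp]
    exact (le_abs_self _).trans (hC x)
  have h2 : bracketSq x ^ (-(n : ℝ)) ≤ (∏ i, (1 + x i ^ 2))⁻¹ := by
    rw [Real.rpow_neg (bracketSq_pos x).le, Real.rpow_natCast]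
    exact inv_anti₀ hp (prod_one_add_sq_le_bracketSq_pow x)
  rw [Finset.prod_inv_distrib, add_mul]
  exact add_le_add h1 (mul_le_mul_of_nonneg_left h2 hc.le)

end bracketSq

/-! ### The transport estimate behind the Sobolev inequality -/

section KnotheSobolev

variable {n : ℕ}

theorem hasLineDerivAt_single_of_hasDerivAt_update {f : (Fin n → ℝ) → ℝ} {f' : ℝ}
    {x : Fin n → ℝ} {i : Fin n}
    (h : HasDerivAt (fun s => f (Function.update x i s)) f' (x i)) :
    HasLineDerivAt ℝ f f' x (Pi.single i 1) := by
  unfold HasLineDerivAt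
  have h1 : HasDerivAt (fun t : ℝ => f (Function.update x i (x i + t))) f' 0 := by
    refine HasDerivAt.comp_const_add (f := fun s => f (Function.update x i s)) (x i) 0 ?_
    rwa [add_zero]
  refine h1.congr_of_eventuallyEq (Filter.Eventually.of_forall fun t => ?_)
  simp only
  congr 1
  ext j
  by_cases hj : j = i
  · subst hj; simp
  · simp [hj]

/-- The divergence formula for a map `T` of which only the diagonal derivatives `∂ᵢTᵢ = D i` are
known to exist. -/
theorem integral_mul_sum_diag_deriv {T D : (Fin n → ℝ) → Fin n → ℝ} (hT : Continuous T)
    (hD : Continuous D)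
    (hTD : ∀ x i, HasDerivAt (fun s => T (Function.update x i s) i) (D x i) (x i))
    {ψ : (Fin n → ℝ) → ℝ} {ψ' : Fin n → (Fin n → ℝ) → ℝ} (hψ : Continuous ψ)
    (hψc : HasCompactSupport ψ) (hψ' : ∀ i, Continuous (ψ' i))
    (hψc' : ∀ i, HasCompactSupport (ψ' i))
    (hψd : ∀ x i, HasLineDerivAt ℝ ψ (ψ' i x) x (Pi.single i 1)) :
    ∫ x, ψ x * ∑ i, D x i = -∫ x, ∑ i, T x i * ψ' i x := by
  have hTi : ∀ i, Continuous fun x => T x i := fun i => (continuous_apply i).comp hT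
  have hDi : ∀ i, Continuous fun x => D x i := fun i => (continuous_apply i).comp hD
  have i1 : ∀ i, Integrable fun x => D x i * ψ x := fun i =>
    ((hDi i).mul hψ).integrable_of_hasCompactSupport hψc.mul_left
  have i2 : ∀ i, Integrable fun x => T x i * ψ' i x := fun i =>
    ((hTi i).mul (hψ' i)).integrable_of_hasCompactSupport (hψc' i).mul_left
  have i3 : ∀ i, Integrable fun x => T x i * ψ x := fun i =>
    ((hTi i).mul hψ).integrable_of_hasCompactSupport hψc.mul_left
  have key : ∀ i, ∫ x, T x i * ψ' i x = -∫ x, D x i * ψ x := fun i =>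
    integral_bilinear_hasLineDerivAt_right_eq_neg_left_of_integrable
      (B := ContinuousLinearMap.mul ℝ ℝ) (i1 i) (i2 i) (i3 i)
      (fun x _ => hasLineDerivAt_single_of_hasDerivAt_update (f := fun x => T x i) (hTD x i))
      (fun x _ => hψd x i)
  rw [integral_finsetSum _ fun i _ => i2 i, Finset.sum_congr rfl fun i _ => key i,
    Finset.sum_neg_distrib, neg_neg, ← integral_finsetSum _ fun i _ => i1 i]
  refine integral_congr_ae (ae_of_all _ fun x => ?_)
  simp only [Finset.mul_sum]
  exact Finset.sum_congr rfl fun i _ => mul_comm _ _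

/-- Change of variables along a transport map, for nonnegative integrands that need not be
integrable. -/
theorem integral_comp_mul_of_transport {T : (Fin n → ℝ) → Fin n → ℝ} {F G h : (Fin n → ℝ) → ℝ}
    (hT : Continuous T) (hF : IsDecayingDensity F) (hG : IsDecayingDensity G)
    (hpush : ∀ w : (Fin n → ℝ) → ℝ≥0∞, Measurable w →
        ∫⁻ x, w (T x) * ENNReal.ofReal (F x) = ∫⁻ y, w y * ENNReal.ofReal (G y))
    (hh : Continuous h) (hh0 : ∀ y, 0 ≤ h y) :
    ∫ x, h (T x) * F x = ∫ y, h y * G y := by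
  rw [integral_eq_lintegral_of_nonneg_ae (ae_of_all _ fun x => mul_nonneg (hh0 _) (hF.pos x).le)
    ((hh.comp hT).mul hF.continuous).aestronglyMeasurable,
    integral_eq_lintegral_of_nonneg_ae (ae_of_all _ fun x => mul_nonneg (hh0 _) (hG.pos x).le)
    (hh.mul hG.continuous).aestronglyMeasurable]
  simp_rw [ENNReal.ofReal_mul (hh0 _)]
  rw [hpush (fun y => ENNReal.ofReal (h y)) hh.measurable.ennreal_ofReal]

theorem integrable_comp_mul_of_transport {T : (Fin n → ℝ) → Fin n → ℝ} {F G h : (Fin n → ℝ) → ℝ}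
    (hT : Continuous T) (hF : IsDecayingDensity F) (hG : IsDecayingDensity G)
    (hpush : ∀ w : (Fin n → ℝ) → ℝ≥0∞, Measurable w →
        ∫⁻ x, w (T x) * ENNReal.ofReal (F x) = ∫⁻ y, w y * ENNReal.ofReal (G y))
    (hh : Continuous h) (hh0 : ∀ y, 0 ≤ h y) (hi : Integrable fun y => h y * G y) :
    Integrable fun x => h (T x) * F x := by
  refine ⟨((hh.comp hT).mul hF.continuous).aestronglyMeasurable, ?_⟩
  have h1 := hi.2
  rw [hasFiniteIntegral_iff_ofReal (ae_of_all _ fun x => mul_nonneg (hh0 _) (hF.pos x).le)]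
  rw [hasFiniteIntegral_iff_ofReal (ae_of_all _ fun x => mul_nonneg (hh0 _) (hG.pos x).le)] at h1
  simp_rw [ENNReal.ofReal_mul (hh0 _)] at h1 ⊢
  rwa [hpush (fun y => ENNReal.ofReal (h y)) hh.measurable.ennreal_ofReal]

/-- The second moment of the transported density, for a target that is a multiple of the extremal
profile. -/
theorem integral_mul_sum_sq_le_of_transport (hn : 3 ≤ n) {T : (Fin n → ℝ) → Fin n → ℝ}
    {F f : (Fin n → ℝ) → ℝ} {c : ℝ} (hT : Continuous T) (hF : IsDecayingDensity F)
    (hG : IsDecayingDensity fun x : Fin n → ℝ => c * bracketSq x ^ (-(n : ℝ)))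
    (hpush : ∀ w : (Fin n → ℝ) → ℝ≥0∞, Measurable w → ∫⁻ x, w (T x) * ENNReal.ofReal (F x) =
      ∫⁻ y, w y * ENNReal.ofReal (c * bracketSq y ^ (-(n : ℝ))))
    (hf : Continuous f) (hfc : HasCompactSupport f) (hfF : ∀ x, f x ≤ F x) :
    ∫ x, f x * ∑ i, T x i ^ 2 ≤ c * ((∫ x : Fin n → ℝ, bracketSq x ^ (-((n : ℝ) - 1))) -
      ∫ x : Fin n → ℝ, bracketSq x ^ (-(n : ℝ))) := by
  have hn3 : (3 : ℝ) ≤ n := by exact_mod_cast hn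
  have i₀ : Integrable fun x : Fin n → ℝ => bracketSq x ^ (-(n : ℝ)) :=
    integrable_bracketSq_rpow_neg (by linarith)
  have i₁ : Integrable fun x : Fin n → ℝ => bracketSq x ^ (-((n : ℝ) - 1)) :=
    integrable_bracketSq_rpow_neg (by linarith)
  have hsplit : ∀ x : Fin n → ℝ, (∑ i, x i ^ 2) * (c * bracketSq x ^ (-(n : ℝ))) =
      c * (bracketSq x ^ (-((n : ℝ) - 1)) - bracketSq x ^ (-(n : ℝ))) := by
    intro x
    have hB1 : ∑ i, x i ^ 2 = bracketSq x - 1 := by simp [bracketSq]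
    rw [show -((n : ℝ) - 1) = 1 + -n by ring, Real.rpow_add (bracketSq_pos x), Real.rpow_one, hB1]
    ring
  have hsqi : Integrable fun y : Fin n → ℝ => (∑ i, y i ^ 2) * (c * bracketSq y ^ (-(n : ℝ))) := by
    simp_rw [hsplit]
    exact (i₁.sub i₀).const_mul _
  have hsum : Continuous fun x : Fin n → ℝ => ∑ i, x i ^ 2 := by fun_prop
  have hsum0 : ∀ x : Fin n → ℝ, 0 ≤ ∑ i, x i ^ 2 :=
    fun x => Finset.sum_nonneg fun i _ => sq_nonneg _
  have hTint : Integrable fun x => (∑ i, T x i ^ 2) * F x :=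
    integrable_comp_mul_of_transport (h := fun y => ∑ i, y i ^ 2) hT hF hG hpush hsum hsum0 hsqi
  have hfT : Integrable fun x => f x * ∑ i, T x i ^ 2 :=
    (hf.mul (hsum.comp hT)).integrable_of_hasCompactSupport hfc.mul_right
  calc ∫ x, f x * ∑ i, T x i ^ 2 ≤ ∫ x, (∑ i, T x i ^ 2) * F x := by
        refine integral_mono hfT hTint fun x => ?_
        rw [mul_comm]
        exact mul_le_mul_of_nonneg_left (hfF x) (hsum0 (T x))
    _ = ∫ y : Fin n → ℝ, (∑ i, y i ^ 2) * (c * bracketSq y ^ (-(n : ℝ))) :=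
        integral_comp_mul_of_transport (h := fun y => ∑ i, y i ^ 2) hT hF hG hpush hsum hsum0
    _ = _ := by
        simp_rw [hsplit]
        rw [integral_const_mul, integral_sub i₁ i₀]

/-- The arithmetic–geometric mean inequality with equal weights. -/
theorem prod_rpow_inv_card_le (hn : 0 < n) {z : Fin n → ℝ} (hz : ∀ i, 0 ≤ z i) :
    (∏ i, z i) ^ (1 / (n : ℝ)) ≤ 1 / n * ∑ i, z i := by
  have hn' : (n : ℝ) ≠ 0 := by positivity
  have h := Real.geom_mean_le_arith_mean_weighted Finset.univ (fun _ : Fin n => 1 / (n : ℝ)) z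
    (fun i _ => by positivity) (by simp [hn']) (fun i _ => hz i)
  rwa [Real.finsetProd_rpow _ _ fun i _ => hz i, ← Finset.mul_sum] at h

theorem ContDiff.continuous_fderiv_single {u : (Fin n → ℝ) → ℝ} (hu : ContDiff ℝ 1 u) (i : Fin n) :
    Continuous fun x => fderiv ℝ u x (Pi.single i 1) :=
  (hu.continuous_fderiv one_ne_zero).clm_apply continuous_const

theorem HasCompactSupport.fderiv_single {u : (Fin n → ℝ) → ℝ} (hu : HasCompactSupport u)
    (i : Fin n) : HasCompactSupport fun x => fderiv ℝ u x (Pi.single i 1) :=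
  hu.fderiv_apply (𝕜 := ℝ) _

theorem integrable_fderiv_single_sq {u : (Fin n → ℝ) → ℝ} (hu : ContDiff ℝ 1 u)
    (huc : HasCompactSupport u) (i : Fin n) :
    Integrable fun x => fderiv ℝ u x (Pi.single i 1) ^ 2 := by
  have h : HasCompactSupport fun x => fderiv ℝ u x (Pi.single i 1) ^ 2 :=
    (huc.fderiv_single i).comp_left (g := fun t : ℝ => t ^ 2) (by simp)
  exact ((hu.continuous_fderiv_single i).pow 2).integrable_of_hasCompactSupport h

theorem integrable_sum_fderiv_sq {u : (Fin n → ℝ) → ℝ} (hu : ContDiff ℝ 1 u)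
    (huc : HasCompactSupport u) :
    Integrable fun x => ∑ i, fderiv ℝ u x (Pi.single i 1) ^ 2 :=
  integrable_finsetSum _ fun i _ => integrable_fderiv_single_sq hu huc i

set_option maxHeartbeats 400000 in
/-- The Sobolev inequality before passing to the limit. The parameter `δ` is the weight of the
profile added to `|u|^(2n/(n-2))` to make it a positive density, `l` comes from Young's inequality
and `L` truncates `1 + |T|²`. -/
theorem knothe_sobolev_estimate (hn : 3 ≤ n) {u : (Fin n → ℝ) → ℝ} (hu : ContDiff ℝ 1 u)
    (huc : HasCompactSupport u) {q b P N Z Z₁ δ l L : ℝ} (hq : q = 2 * n / (n - 2))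
    (hb : b = 2 * (n - 1) / (n - 2)) (hP : ∫ x, |u x| ^ q = P)
    (hZ : ∫ x : Fin n → ℝ, bracketSq x ^ (-(n : ℝ)) = Z) (hZ0 : 0 < Z)
    (hZ₁ : ∫ x : Fin n → ℝ, bracketSq x ^ (-((n : ℝ) - 1)) = Z₁)
    (hδ : 0 < δ) (hl : 0 < l) (hL : 0 ≤ L) (hN : N = P + δ * Z) :
    (Z / N) ^ (1 / (n : ℝ)) *
        (N / Z * (∫ x : Fin n → ℝ, min (bracketSq x) L * bracketSq x ^ (-(n : ℝ))) - δ * L * Z) ≤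
      b / n * (l / 2 * (N / Z * (Z₁ - Z)) +
        1 / (2 * l) * ∫ x, ∑ i, fderiv ℝ u x (Pi.single i 1) ^ 2) := by
  have hn3 : (3 : ℝ) ≤ n := by exact_mod_cast hn
  have hn0 : (0 : ℝ) < n := by linarith
  have hn2 : (0 : ℝ) < n - 2 := by linarith
  have hq0 : 0 < q := by rw [hq]; positivity
  have hb2 : 2 < b := by rw [hb, lt_div_iff₀ hn2]; linarith
  set J : (Fin n → ℝ) → ℝ := fun x => bracketSq x ^ (-(n : ℝ)) with hJ
  have hJ0 : ∀ x, 0 < J x := fun x => Real.rpow_pos_of_pos (bracketSq_pos x) _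
  have hJc : Continuous J := continuous_bracketSq.rpow_const fun x => Or.inl (bracketSq_pos x).ne'
  have hJi : Integrable J := integrable_bracketSq_rpow_neg (by linarith)
  set f : (Fin n → ℝ) → ℝ := fun x => |u x| ^ q with hf
  have hf0 : ∀ x, 0 ≤ f x := fun x => Real.rpow_nonneg (abs_nonneg _) _
  have hfcont : Continuous f := hu.continuous.abs.rpow_const fun x => Or.inr hq0.le
  have hfc : HasCompactSupport f :=
    huc.comp_left (g := fun t : ℝ => |t| ^ q) (by simp [Real.zero_rpow hq0.ne'])
  have hfi : Integrable f := hfcont.integrable_of_hasCompactSupport hfc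
  have hP0 : 0 ≤ P := hP ▸ integral_nonneg hf0
  have hN0 : 0 < N := by rw [hN]; positivity
  have hF := isDecayingDensity_add_bracketSq hfcont hf0 hfc hδ
  have hG := isDecayingDensity_add_bracketSq (n := n) (f := 0) continuous_zero (fun _ => le_rfl)
    HasCompactSupport.zero (div_pos hN0 hZ0)
  simp only [Pi.zero_apply, zero_add] at hG
  change IsDecayingDensity fun x => f x + δ * J x at hF
  change IsDecayingDensity fun x => N / Z * J x at hG
  have hFi : Integrable fun x => f x + δ * J x := hfi.add (hJi.const_mul δ)
  have hmass : ∫⁻ x, ENNReal.ofReal (f x + δ * J x) = ∫⁻ x, ENNReal.ofReal (N / Z * J x) := by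
    rw [← ofReal_integral_eq_lintegral_ofReal hFi (ae_of_all _ fun x => (hF.pos x).le),
      ← ofReal_integral_eq_lintegral_ofReal (hJi.const_mul _) (ae_of_all _ fun x => (hG.pos x).le),
      integral_add hfi (hJi.const_mul δ), integral_const_mul, integral_const_mul, hP, hZ, hN]
    congr 1
    field_simp
  obtain ⟨T, D, hT, hD, hTD, hDp, hjac, hpush⟩ := exists_knothe_map n hF hG hmass
  -- the test function `ψ = |u|^b` and its partial derivatives
  set ψ : (Fin n → ℝ) → ℝ := fun x => |u x| ^ b with hψ
  have hψ0 : ∀ x, 0 ≤ ψ x := fun x => Real.rpow_nonneg (abs_nonneg _) _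
  have hψcont : Continuous ψ := hu.continuous.abs.rpow_const fun x => Or.inr (by linarith)
  have hψc : HasCompactSupport ψ :=
    huc.comp_left (g := fun t : ℝ => |t| ^ b) (by simp [Real.zero_rpow (by linarith : b ≠ 0)])
  set a : (Fin n → ℝ) → ℝ := fun x => |u x| ^ (b - 2) * u x with ha
  have hacont : Continuous a :=
    (hu.continuous.abs.rpow_const fun x => Or.inr (by linarith)).mul hu.continuous
  have ha2 : ∀ x, a x ^ 2 = f x := by
    intro x
    simp only [ha, hf, mul_pow]
    rw [← sq_abs (u x), ← Real.rpow_natCast (|u x| ^ (b - 2)), ← Real.rpow_natCast (|u x|),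
      ← Real.rpow_mul (abs_nonneg _),
      ← Real.rpow_add_of_nonneg (abs_nonneg _) (by push_cast; linarith) (by positivity)]
    congr 1
    rw [hb, hq]; push_cast; field_simp; ring
  set ψ' : Fin n → (Fin n → ℝ) → ℝ := fun i x => b * a x * fderiv ℝ u x (Pi.single i 1) with hψ'
  have hdu := hu.continuous_fderiv_single
  have hψd : ∀ x i, HasLineDerivAt ℝ ψ (ψ' i x) x (Pi.single i 1) := by
    intro x i
    have h1 : HasFDerivAt u (fderiv ℝ u x) x :=
      (hu.differentiable one_ne_zero x).hasFDerivAt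
    have h2 := (hasDerivAt_abs_rpow (u x) (by linarith : 1 < b)).comp_hasFDerivAt x h1
    have h3 := h2.hasLineDerivAt (Pi.single i 1)
    convert! h3 using 1
    simp only [hψ', ha, smul_apply, smul_eq_mul]
    ring
  have hψ'c : ∀ i, Continuous (ψ' i) := fun i => (continuous_const.mul hacont).mul (hdu i)
  have hψ's : ∀ i, HasCompactSupport (ψ' i) := fun i => (huc.fderiv_single i).mul_left
  -- arithmetic-geometric mean inequality for the diagonal of the Jacobian matrix
  have hpt : ∀ x, (Z / N) ^ (1 / (n : ℝ)) * (f x * min (bracketSq (T x)) L) ≤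
      1 / n * (ψ x * ∑ i, D x i) := by
    intro x
    have h1 := prod_rpow_inv_card_le (by omega : 0 < n) fun i => (hDp x i).le
    have hB := bracketSq_pos (T x)
    have h2 : f x * (Z / N) * bracketSq (T x) ^ (n : ℝ) ≤ ∏ i, D x i := by
      have h3 := hjac x
      have h4 : J (T x) * bracketSq (T x) ^ (n : ℝ) = 1 := by
        simp only [hJ]
        rw [← Real.rpow_add hB, neg_add_cancel, Real.rpow_zero]
      calc f x * (Z / N) * bracketSq (T x) ^ (n : ℝ)
          ≤ (f x + δ * J x) * (Z / N) * bracketSq (T x) ^ (n : ℝ) := by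
            have := (mul_pos hδ (hJ0 x)).le
            gcongr
            linarith
        _ = (∏ i, D x i) * (J (T x) * bracketSq (T x) ^ (n : ℝ)) := by
            rw [← h3]; field_simp
        _ = ∏ i, D x i := by rw [h4, mul_one]
    have h5 : f x ^ (1 / (n : ℝ)) * (Z / N) ^ (1 / (n : ℝ)) * bracketSq (T x) ≤
        (∏ i, D x i) ^ (1 / (n : ℝ)) := by
      refine le_trans (le_of_eq ?_) (Real.rpow_le_rpow (by have := hf0 x; positivity) h2
        (by positivity))
      rw [Real.mul_rpow (by have := hf0 x; positivity) (by positivity),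
        Real.mul_rpow (hf0 x) (by positivity), ← Real.rpow_mul hB.le, mul_one_div_cancel hn0.ne',
        Real.rpow_one]
    have h6 : ψ x * f x ^ (1 / (n : ℝ)) = f x := by
      simp only [hψ, hf]
      rw [← Real.rpow_mul (abs_nonneg _),
        ← Real.rpow_add_of_nonneg (abs_nonneg _) (by linarith) (by positivity)]
      congr 1
      rw [hb, hq]; field_simp; ring
    calc (Z / N) ^ (1 / (n : ℝ)) * (f x * min (bracketSq (T x)) L)
        ≤ (Z / N) ^ (1 / (n : ℝ)) * (f x * bracketSq (T x)) := by
          have := hf0 x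
          gcongr
          exact min_le_left _ _
      _ = ψ x * (f x ^ (1 / (n : ℝ)) * (Z / N) ^ (1 / (n : ℝ)) * bracketSq (T x)) := by
          nth_rewrite 1 [← h6]; ring
      _ ≤ ψ x * (1 / n * ∑ i, D x i) := mul_le_mul_of_nonneg_left (h5.trans h1) (hψ0 x)
      _ = _ := by ring
  have hmincont : Continuous fun x : Fin n → ℝ => min (bracketSq x) L :=
    continuous_bracketSq.min continuous_const
  have hmin0 : ∀ x : Fin n → ℝ, 0 ≤ min (bracketSq x) L := fun x => le_min (bracketSq_pos x).le hL
  have hTi : ∀ i, Continuous fun x => T x i := fun i => (continuous_apply i).comp hT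
  have hDi : ∀ i, Continuous fun x => D x i := fun i => (continuous_apply i).comp hD
  -- the left-hand side
  have hlow : N / Z * (∫ x, min (bracketSq x) L * J x) - δ * L * Z ≤
      ∫ x, f x * min (bracketSq (T x)) L := by
    have hbdd : ∀ g : (Fin n → ℝ) → ℝ, Integrable g →
        Integrable fun x => min (bracketSq (T x)) L * g x := fun g hg =>
      hg.bdd_mul (c := L) (hmincont.comp hT).aestronglyMeasurable
        (ae_of_all _ fun x => by
          rw [Real.norm_of_nonneg (hmin0 _)]
          exact min_le_right _ _)
    have h1 := integral_comp_mul_of_transport hT hF hG hpush hmincont hmin0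
    have h2 : ∫ x, min (bracketSq (T x)) L * (f x + δ * J x) =
        (∫ x, f x * min (bracketSq (T x)) L) + ∫ x, min (bracketSq (T x)) L * (δ * J x) := by
      rw [← integral_add]
      · refine integral_congr_ae (ae_of_all _ fun x => ?_)
        simp only
        ring
      · exact (hbdd f hfi).congr (ae_of_all _ fun x => mul_comm _ _)
      · exact hbdd _ (hJi.const_mul δ)
    have h3 : ∫ x, min (bracketSq (T x)) L * (δ * J x) ≤ δ * L * Z := by
      rw [← hZ, ← integral_const_mul]
      refine integral_mono (hbdd _ (hJi.const_mul δ)) (hJi.const_mul _) fun x => ?_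
      have := mul_le_mul_of_nonneg_right (min_le_right (bracketSq (T x)) L)
        (mul_pos hδ (hJ0 x)).le
      simp only
      linarith
    have h4 : ∫ x, min (bracketSq x) L * (N / Z * J x) =
        N / Z * ∫ x, min (bracketSq x) L * J x := by
      rw [← integral_const_mul]
      refine integral_congr_ae (ae_of_all _ fun x => ?_)
      simp only
      ring
    linarith
  -- the second moment of `T`
  have hsq : ∫ x, f x * ∑ i, T x i ^ 2 ≤ N / Z * (Z₁ - Z) := by
    have h := integral_mul_sum_sq_le_of_transport hn hT hF hG hpush hfcont hfc
      fun x => le_add_of_nonneg_right (mul_pos hδ (hJ0 x)).le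
    rwa [hZ, hZ₁] at h
  have hTsum : Continuous fun x => ∑ i, T x i ^ 2 :=
    continuous_finsetSum _ fun i _ => (hTi i).pow 2
  have hDsum : Continuous fun x => ∑ i, D x i := continuous_finsetSum _ fun i _ => hDi i
  have hfT : Integrable fun x => f x * ∑ i, T x i ^ 2 :=
    (hfcont.mul hTsum).integrable_of_hasCompactSupport hfc.mul_right
  have hEi := integrable_sum_fderiv_sq hu huc
  calc (Z / N) ^ (1 / (n : ℝ)) * (N / Z * (∫ x, min (bracketSq x) L * J x) - δ * L * Z)
      ≤ (Z / N) ^ (1 / (n : ℝ)) * ∫ x, f x * min (bracketSq (T x)) L :=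
        mul_le_mul_of_nonneg_left hlow (by positivity)
    _ = ∫ x, (Z / N) ^ (1 / (n : ℝ)) * (f x * min (bracketSq (T x)) L) :=
        (integral_const_mul _ _).symm
    _ ≤ ∫ x, 1 / n * (ψ x * ∑ i, D x i) := by
        refine integral_mono ?_ ?_ hpt
        · exact ((hfcont.mul (hmincont.comp hT)).integrable_of_hasCompactSupport
            hfc.mul_right).const_mul _
        · exact ((hψcont.mul hDsum).integrable_of_hasCompactSupport
            hψc.mul_right).const_mul _
    _ = 1 / n * ∫ x, -∑ i, T x i * ψ' i x := by
        rw [integral_const_mul, integral_mul_sum_diag_deriv hT hD hTD hψcont hψc hψ'c hψ's hψd,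
          integral_neg]
    _ ≤ 1 / n * ∫ x, b * (l / 2 * (f x * ∑ i, T x i ^ 2) +
          1 / (2 * l) * ∑ i, fderiv ℝ u x (Pi.single i 1) ^ 2) := by
        refine mul_le_mul_of_nonneg_left (integral_mono ?_ ?_ fun x => ?_) (by positivity)
        · exact (integrable_finsetSum _ fun i _ => ((hTi i).mul
            (hψ'c i)).integrable_of_hasCompactSupport (hψ's i).mul_left).neg
        · exact ((hfT.const_mul _).add (hEi.const_mul _)).const_mul _
        · simp only
          rw [← ha2 x, Finset.mul_sum, Finset.mul_sum, Finset.mul_sum, ← Finset.sum_add_distrib,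
            Finset.mul_sum, ← Finset.sum_neg_distrib]
          refine Finset.sum_le_sum fun i _ => ?_
          simp only [hψ']
          set y := fderiv ℝ u x (Pi.single i 1)
          have h1 : 0 ≤ b / (2 * l) * (l * (a x * T x i) + y) ^ 2 := by positivity
          have h2 : b / (2 * l) * (l * (a x * T x i) + y) ^ 2 =
              b * (l / 2 * (a x ^ 2 * T x i ^ 2) + 1 / (2 * l) * y ^ 2) + T x i * (b * a x * y) := by
            field_simp
            ring
          linarith
    _ = b / n * (l / 2 * (∫ x, f x * ∑ i, T x i ^ 2) +
          1 / (2 * l) * ∫ x, ∑ i, fderiv ℝ u x (Pi.single i 1) ^ 2) := by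
        rw [integral_const_mul, integral_add (hfT.const_mul _) (hEi.const_mul _),
          integral_const_mul, integral_const_mul]
        ring
    _ ≤ _ := by gcongr

end KnotheSobolev

/-! ### The sharp Sobolev inequality -/

section SharpSobolev

variable {n : ℕ}

/-- **Sharp Sobolev inequality** for compactly supported `C¹` functions; the constant is expressed
by the mass `Z` of the extremal profile `(1 + |x|²)^(-n)`. -/
theorem sharp_sobolev_mass (hn : 3 ≤ n) {u : (Fin n → ℝ) → ℝ} (hu : ContDiff ℝ 1 u)
    (huc : HasCompactSupport u) {Z : ℝ}
    (hZ : Z = Real.pi ^ ((n : ℝ) / 2) * Real.Gamma (n / 2) / Real.Gamma n) :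
    (∫ x, |u x| ^ (2 * (n : ℝ) / (n - 2))) ^ (1 - 2 / (n : ℝ)) * Z ^ (2 / (n : ℝ)) *
        (n * (n - 2)) ≤
      ∫ x, ∑ i, fderiv ℝ u x (Pi.single i 1) ^ 2 := by
  have hn3 : (3 : ℝ) ≤ n := by exact_mod_cast hn
  have hn0 : (0 : ℝ) < n := by linarith
  have hn2 : (0 : ℝ) < n - 2 := by linarith
  have hΓ₁ := Real.Gamma_pos_of_pos (by linarith : (0 : ℝ) < n / 2 - 1)
  have hΓ₂ := Real.Gamma_pos_of_pos (by linarith : (0 : ℝ) < n - 1)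
  have hΓ₃ := Real.Gamma_pos_of_pos (by linarith : (0 : ℝ) < n / 2)
  have hΓ₄ := Real.Gamma_pos_of_pos hn0
  have hZ0 : 0 < Z := by rw [hZ]; positivity
  obtain ⟨b, hb⟩ : ∃ b, b = 2 * ((n : ℝ) - 1) / (n - 2) := ⟨_, rfl⟩
  have hb0 : 0 < b := by rw [hb]; exact div_pos (by linarith) hn2
  have hb1 : b - 1 = n / (n - 2) := by rw [hb]; field_simp; ring
  have hJ : ∫ x : Fin n → ℝ, bracketSq x ^ (-(n : ℝ)) = Z := by
    rw [integral_bracketSq_rpow_neg (by linarith), hZ, sub_half]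
  have hJ₁i : Integrable fun x : Fin n → ℝ => bracketSq x ^ (-((n : ℝ) - 1)) :=
    integrable_bracketSq_rpow_neg (by linarith)
  have hJ₁ : ∫ x : Fin n → ℝ, bracketSq x ^ (-((n : ℝ) - 1)) = b * Z := by
    have h1 : Real.Gamma (n / 2) = (n / 2 - 1) * Real.Gamma (n / 2 - 1) := by
      rw [← Real.Gamma_add_one (by linarith), sub_add_cancel]
    have h2 : Real.Gamma n = (n - 1) * Real.Gamma (n - 1) := by
      rw [← Real.Gamma_add_one (by linarith), sub_add_cancel]
    have h3 : (n : ℝ) - 1 ≠ 0 := by linarith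
    rw [integral_bracketSq_rpow_neg (by linarith), hZ, h1, h2, hb,
      show (n : ℝ) - 1 - n / 2 = n / 2 - 1 by ring]
    field_simp
  obtain ⟨P, hP⟩ : ∃ P, ∫ x, |u x| ^ (2 * (n : ℝ) / (n - 2)) = P := ⟨_, rfl⟩
  obtain ⟨E, hE⟩ : ∃ E, ∫ x, ∑ i, fderiv ℝ u x (Pi.single i 1) ^ 2 = E := ⟨_, rfl⟩
  have hE0 : 0 ≤ E := hE ▸ integral_nonneg fun x => Finset.sum_nonneg fun i _ => sq_nonneg _
  have hP0 : 0 ≤ P := hP ▸ integral_nonneg fun x => Real.rpow_nonneg (abs_nonneg _) _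
  rw [hP, hE]
  rcases hP0.eq_or_lt with hP0 | hP0
  · have h2n := (div_lt_one hn0).2 (by linarith : (2 : ℝ) < n)
    rw [← hP0, Real.zero_rpow (by linarith)]
    simpa using hE0
  -- let the weight `δ` of the added profile tend to zero
  have hδ : ∀ l L : ℝ, 0 < l → 0 ≤ L → (Z / P) ^ (1 / (n : ℝ)) *
      (P / Z * (∫ x : Fin n → ℝ, min (bracketSq x) L * bracketSq x ^ (-(n : ℝ)))) ≤
        b / n * (l / 2 * (P / Z * (b * Z - Z)) + 1 / (2 * l) * E) := by
    intro l L hl hL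
    have hlim : Filter.Tendsto (fun δ : ℝ => P + δ * Z) (nhdsWithin 0 (Set.Ioi 0)) (nhds P) := by
      have : ContinuousAt (fun δ : ℝ => P + δ * Z) 0 := by fun_prop
      simpa using this.tendsto.mono_left nhdsWithin_le_nhds
    have hlim2 : Filter.Tendsto (fun δ : ℝ => δ * L * Z) (nhdsWithin 0 (Set.Ioi 0)) (nhds 0) := by
      have : ContinuousAt (fun δ : ℝ => δ * L * Z) 0 := by fun_prop
      simpa using this.tendsto.mono_left nhdsWithin_le_nhds
    have h1 := (((tendsto_const_nhds (x := Z)).div hlim hP0.ne').rpow_const (p := 1 / (n : ℝ))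
      (Or.inl (div_pos hZ0 hP0).ne')).mul (((hlim.div_const Z).mul_const
        (∫ x : Fin n → ℝ, min (bracketSq x) L * bracketSq x ^ (-(n : ℝ)))).sub hlim2)
    have h2 := ((((hlim.div_const Z).mul_const (b * Z - Z)).const_mul (l / 2)).add_const
      (1 / (2 * l) * E)).const_mul (b / n)
    rw [sub_zero] at h1
    refine le_of_tendsto_of_tendsto h1 h2 ?_
    filter_upwards [self_mem_nhdsWithin] with δ hδ
    have := knothe_sobolev_estimate hn hu huc rfl hb hP hJ hZ0 hJ₁ hδ hl hL rfl
    rwa [hE] at this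
  -- remove the truncation
  have hL : ∀ l : ℝ, 0 < l → (Z / P) ^ (1 / (n : ℝ)) * (P / Z * (b * Z)) ≤
      b / n * (l / 2 * (P / Z * (b * Z - Z)) + 1 / (2 * l) * E) := by
    intro l hl
    have hmul : ∀ x : Fin n → ℝ,
        bracketSq x ^ (-((n : ℝ) - 1)) = bracketSq x * bracketSq x ^ (-(n : ℝ)) := by
      intro x
      rw [show -((n : ℝ) - 1) = 1 + -n by ring, Real.rpow_add (bracketSq_pos x), Real.rpow_one]
    have hJ0 : ∀ x : Fin n → ℝ, 0 < bracketSq x ^ (-(n : ℝ)) :=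
      fun x => Real.rpow_pos_of_pos (bracketSq_pos x) _
    have hJc : Continuous fun x : Fin n → ℝ => bracketSq x ^ (-(n : ℝ)) :=
      continuous_bracketSq.rpow_const fun x => Or.inl (bracketSq_pos x).ne'
    have hK : Filter.Tendsto (fun k : ℕ => ∫ x : Fin n → ℝ,
        min (bracketSq x) (k : ℝ) * bracketSq x ^ (-(n : ℝ))) Filter.atTop (nhds (b * Z)) := by
      rw [← hJ₁]
      refine tendsto_integral_of_dominated_convergence
        (fun x : Fin n → ℝ => bracketSq x ^ (-((n : ℝ) - 1)))
        (fun k => ((continuous_bracketSq.min continuous_const).mul hJc).aestronglyMeasurable)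
        hJ₁i (fun k => ae_of_all _ fun x => ?_) (ae_of_all _ fun x => ?_)
      · have h0 : 0 ≤ min (bracketSq x) (k : ℝ) := le_min (bracketSq_pos x).le (Nat.cast_nonneg k)
        rw [Real.norm_of_nonneg (mul_nonneg h0 (hJ0 x).le), hmul]
        exact mul_le_mul_of_nonneg_right (min_le_left _ _) (hJ0 x).le
      · refine tendsto_const_nhds.congr' ?_
        filter_upwards [Filter.eventually_ge_atTop ⌈bracketSq x⌉₊] with k hk
        rw [min_eq_left (Nat.ceil_le.1 hk), hmul]
    exact le_of_tendsto ((hK.const_mul (P / Z)).const_mul _)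
      (Filter.Eventually.of_forall fun k => hδ l k hl (Nat.cast_nonneg k))
  -- optimize over the parameter `l` of Young's inequality
  set X := (Z / P) ^ (1 / (n : ℝ)) * P with hX
  have hX0 : 0 < X := by positivity
  have hmain : n * (n - 2) * X ^ 2 ≤ E * P := by
    have h := hL ((n - 2) * X / P) (by positivity)
    have e1 : (Z / P) ^ (1 / (n : ℝ)) * (P / Z * (b * Z)) = b * X := by rw [hX]; field_simp
    have e2 : P / Z * (b * Z - Z) = P * (n / (n - 2)) := by rw [← hb1]; field_simp
    rw [e1, e2, div_mul_eq_mul_div, mul_div_assoc] at h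
    have h' := le_of_mul_le_mul_left h hb0
    rw [le_div_iff₀ hn0] at h'
    have e3 : (n - 2) * X / P / 2 * (P * (n / (n - 2))) = X * n / 2 := by field_simp
    have e4 : 1 / (2 * ((n - 2) * X / P)) * E = E * P / (2 * (n - 2) * X) := by field_simp
    rw [e3, e4] at h'
    have h'' : X * n / 2 ≤ E * P / (2 * (n - 2) * X) := by linarith
    rw [le_div_iff₀ (by positivity)] at h''
    linarith
  have hX2 : X ^ 2 = P ^ (1 - 2 / (n : ℝ)) * Z ^ (2 / (n : ℝ)) * P := by
    rw [hX, mul_pow, ← Real.rpow_natCast ((Z / P) ^ _), ← Real.rpow_mul (by positivity),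
      Real.div_rpow hZ0.le hP0.le, Real.rpow_sub hP0, Real.rpow_one]
    have : 1 / (n : ℝ) * ((2 : ℕ) : ℝ) = 2 / n := by push_cast; ring
    rw [this]
    field_simp
  rw [hX2] at hmain
  refine le_of_mul_le_mul_right ?_ hP0
  linarith

end SharpSobolev

/-! ### Integration along coordinate lines in dimensions one and two -/

/-- The Dirichlet integral `∫ |∇u|²` with values in `[0, ∞]`. -/
noncomputable def dirichletEnergy {n : ℕ} (u : (Fin n → ℝ) → ℝ) : ℝ≥0∞ :=
  ∫⁻ x, ∑ i, ‖fderiv ℝ u x (Pi.single i 1)‖ₑ ^ 2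

section LineIntegrals

variable {n : ℕ}

/-- A compactly supported function is bounded by the integral of its partial derivative along any
coordinate line. -/
theorem enorm_le_lintegral_partial_deriv {u : (Fin n → ℝ) → ℝ} (hu : ContDiff ℝ 1 u)
    (huc : HasCompactSupport u) (x : Fin n → ℝ) (i : Fin n) :
    ‖u x‖ₑ ≤ ∫⁻ s, ‖fderiv ℝ u (Function.update x i s) (Pi.single i 1)‖ₑ := by
  have h1 : ContDiff ℝ 1 (u ∘ Function.update x i) := hu.comp (contDiff_update 1 x i)
  have h2 : HasCompactSupport (u ∘ Function.update x i) :=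
    huc.comp_isClosedEmbedding (isClosedEmbedding_update x i)
  calc ‖u x‖ₑ ≤ ∫⁻ s in Set.Iic (x i), ‖deriv (u ∘ Function.update x i) s‖ₑ :=
        le_trans (by simp) (h2.enorm_le_lintegral_Ici_deriv h1 (x i))
    _ ≤ ∫⁻ s, ‖deriv (u ∘ Function.update x i) s‖ₑ := setLIntegral_le_lintegral _ _
    _ = _ := by
        refine lintegral_congr fun s => ?_
        rw [fderiv_comp_deriv _ (hu.differentiable one_ne_zero).differentiableAt
          (hasDerivAt_update x i s).differentiableAt, deriv_update]

theorem fderiv_pow_single {u : (Fin n → ℝ) → ℝ} (hu : ContDiff ℝ 1 u) (k : ℕ) (x : Fin n → ℝ)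
    (i : Fin n) : fderiv ℝ (fun y => u y ^ (k + 1)) x (Pi.single i 1) =
      (k + 1) * (u x ^ k * fderiv ℝ u x (Pi.single i 1)) := by
  have h := ((hu.differentiable one_ne_zero x).hasFDerivAt.pow (k + 1)).fderiv
  have h' : fderiv ℝ (fun y => u y ^ (k + 1)) x = _ := h
  rw [h']
  simp
  ring

theorem measurable_enorm_fderiv_single {u : (Fin n → ℝ) → ℝ} (hu : ContDiff ℝ 1 u) (i : Fin n) :
    Measurable fun x => ‖fderiv ℝ u x (Pi.single i 1)‖ₑ :=
  (hu.continuous_fderiv_single i).measurable.enorm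

theorem lintegral_partial_deriv_sq_le {u : (Fin n → ℝ) → ℝ} (i : Fin n) :
    ∫⁻ x, ‖fderiv ℝ u x (Pi.single i 1)‖ₑ ^ 2 ≤ dirichletEnergy u :=
  lintegral_mono fun x => Finset.single_le_sum
    (f := fun j => ‖fderiv ℝ u x (Pi.single j 1)‖ₑ ^ 2) (fun _ _ => zero_le) (Finset.mem_univ i)

theorem lintegral_mul_le_sqrt_mul_sqrt {α : Type*} [MeasurableSpace α] {μ : Measure α}
    {f g : α → ℝ≥0∞} (hf : Measurable f) (hg : Measurable g) :
    ∫⁻ x, f x * g x ∂μ ≤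
      (∫⁻ x, f x ^ 2 ∂μ) ^ (1 / 2 : ℝ) * (∫⁻ x, g x ^ 2 ∂μ) ^ (1 / 2 : ℝ) := by
  have h := ENNReal.lintegral_mul_norm_pow_le (μ := μ) (hf.pow_const 2).aemeasurable
    (hg.pow_const 2).aemeasurable (p := 1 / 2) (q := 1 / 2) (by norm_num) (by norm_num)
    (by norm_num)
  refine le_trans (le_of_eq (lintegral_congr fun x => ?_)) h
  simp only [← ENNReal.rpow_natCast, ← ENNReal.rpow_mul]
  norm_num

/-- The Cauchy–Schwarz inequality applied to `∂ᵢ(u^(k+1)) = (k+1) u^k ∂ᵢu`. -/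
theorem lintegral_partial_deriv_pow_le {u : (Fin n → ℝ) → ℝ} (hu : ContDiff ℝ 1 u) (k : ℕ)
    (i : Fin n) :
    ∫⁻ x, ‖fderiv ℝ (fun y => u y ^ (k + 1)) x (Pi.single i 1)‖ₑ ≤
      (k + 1) * ((∫⁻ x, ‖u x‖ₑ ^ (2 * k)) ^ (1 / 2 : ℝ) * dirichletEnergy u ^ (1 / 2 : ℝ)) := by
  have hc : ‖(k : ℝ) + 1‖ₑ = k + 1 := by
    rw [Real.enorm_eq_ofReal (by positivity), ENNReal.ofReal_add (by positivity) zero_le_one]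
    simp
  simp_rw [fderiv_pow_single hu, enorm_mul, enorm_pow, hc]
  rw [lintegral_const_mul' _ _ (by finiteness)]
  gcongr
  refine (lintegral_mul_le_sqrt_mul_sqrt (hu.continuous.measurable.enorm.pow_const k)
    (measurable_enorm_fderiv_single hu i)).trans ?_
  simp_rw [← pow_mul, mul_comm k 2]
  gcongr
  exact lintegral_partial_deriv_sq_le i

/-- Log-convexity of `r ↦ ∫ |u|^r`. -/
theorem lintegral_rpow_interpolate {α : Type*} [MeasurableSpace α] {μ : Measure α} {f : α → ℝ≥0∞}
    (hf : Measurable f) {r₀ r₁ s t : ℝ} (hr₀ : 0 ≤ r₀) (hr₁ : 0 ≤ r₁) (hs : 0 ≤ s) (ht : 0 ≤ t)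
    (hst : s + t = 1) :
    ∫⁻ x, f x ^ (s * r₀ + t * r₁) ∂μ ≤ (∫⁻ x, f x ^ r₀ ∂μ) ^ s * (∫⁻ x, f x ^ r₁ ∂μ) ^ t := by
  refine le_trans (le_of_eq (lintegral_congr fun x => ?_)) (ENNReal.lintegral_mul_norm_pow_le
    (hf.pow_const r₀).aemeasurable (hf.pow_const r₁).aemeasurable hs ht hst)
  rw [← ENNReal.rpow_mul, ← ENNReal.rpow_mul, ENNReal.rpow_add_of_nonneg _ _ (by positivity)
    (by positivity), mul_comm s, mul_comm t]

end LineIntegrals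

section DimensionOne

theorem lintegral_fin_one (f : (Fin 1 → ℝ) → ℝ≥0∞) :
    ∫⁻ x, f x = ∫⁻ s : ℝ, f fun _ => s :=
  ((volume_preserving_funUnique (Fin 1) ℝ).symm.lintegral_comp_emb
    (MeasurableEquiv.measurableEmbedding _) f).symm

/-- In dimension one `|u|² ≤ 2 ‖u‖₂ ‖u'‖₂` pointwise. -/
theorem enorm_sq_le_of_dim_one {u : (Fin 1 → ℝ) → ℝ} (hu : ContDiff ℝ 1 u)
    (huc : HasCompactSupport u) (x : Fin 1 → ℝ) :
    ‖u x‖ₑ ^ 2 ≤ 2 * ((∫⁻ x, ‖u x‖ₑ ^ 2) ^ (1 / 2 : ℝ) * dirichletEnergy u ^ (1 / 2 : ℝ)) := by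
  have hc : HasCompactSupport fun y => u y ^ (1 + 1) :=
    huc.comp_left (g := fun t : ℝ => t ^ (1 + 1)) (by simp)
  have h := enorm_le_lintegral_partial_deriv (hu.pow (1 + 1)) hc x 0
  have hup : ∀ s, Function.update x 0 s = fun _ => s := by
    intro s
    ext j
    rw [Subsingleton.elim j 0, Function.update_self]
  simp_rw [hup] at h
  rw [← lintegral_fin_one fun y => ‖fderiv ℝ (fun y => u y ^ (1 + 1)) y (Pi.single 0 1)‖ₑ] at h
  have h2 := h.trans (lintegral_partial_deriv_pow_le hu 1 0)
  rw [enorm_pow] at h2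
  convert! h2 using 2
  norm_num

end DimensionOne

section DimensionTwo

theorem lintegral_fin_two {f : (Fin 2 → ℝ) → ℝ≥0∞} (hf : Measurable f) :
    ∫⁻ x, f x = ∫⁻ s : ℝ, ∫⁻ t : ℝ, f ![s, t] := by
  rw [← (volume_preserving_finTwoArrow ℝ).symm.lintegral_comp hf, Measure.volume_eq_prod,
    lintegral_prod (fun a => f (MeasurableEquiv.finTwoArrow.symm a))
      (hf.comp (MeasurableEquiv.measurable _)).aemeasurable]
  rfl

/-- Gagliardo's inequality in the plane. -/
theorem lintegral_sq_le_mul_lintegral_partial_deriv {w : (Fin 2 → ℝ) → ℝ} (hw : ContDiff ℝ 1 w)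
    (hwc : HasCompactSupport w) :
    ∫⁻ x, ‖w x‖ₑ ^ 2 ≤ (∫⁻ x, ‖fderiv ℝ w x (Pi.single 0 1)‖ₑ) *
      ∫⁻ x, ‖fderiv ℝ w x (Pi.single 1 1)‖ₑ := by
  have hm := measurable_enorm_fderiv_single hw
  have hvec : Measurable fun p : ℝ × ℝ => (![p.1, p.2] : Fin 2 → ℝ) := by
    refine measurable_pi_lambda _ fun i => ?_
    fin_cases i
    · exact measurable_fst
    · exact measurable_snd
  rw [lintegral_fin_two (hw.continuous.measurable.enorm.pow_const 2), lintegral_fin_two (hm 0),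
    lintegral_fin_two (hm 1)]
  rw [lintegral_lintegral_swap (f := fun s t => ‖fderiv ℝ w ![s, t] (Pi.single 0 1)‖ₑ)
    ((hm 0).comp hvec).aemeasurable]
  have hA : Measurable fun t => ∫⁻ s, ‖fderiv ℝ w ![s, t] (Pi.single 0 1)‖ₑ :=
    Measurable.lintegral_prod_left' (f := fun p : ℝ × ℝ => ‖fderiv ℝ w ![p.1, p.2] (Pi.single 0 1)‖ₑ)
      ((hm 0).comp hvec)
  have hB : Measurable fun s => ∫⁻ t, ‖fderiv ℝ w ![s, t] (Pi.single 1 1)‖ₑ :=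
    Measurable.lintegral_prod_right' (f := fun p : ℝ × ℝ => ‖fderiv ℝ w ![p.1, p.2] (Pi.single 1 1)‖ₑ)
      ((hm 1).comp hvec)
  rw [← lintegral_const_mul _ hB]
  refine lintegral_mono fun s => ?_
  simp only
  rw [← lintegral_mul_const _ hA]
  refine lintegral_mono fun t => ?_
  simp only
  rw [sq]
  refine mul_le_mul' ?_ ?_
  · refine (enorm_le_lintegral_partial_deriv hw hwc ![s, t] 0).trans (le_of_eq ?_)
    refine lintegral_congr fun s' => ?_
    congr 3
    ext j; fin_cases j <;> simp
  · refine (enorm_le_lintegral_partial_deriv hw hwc ![s, t] 1).trans (le_of_eq ?_)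
    refine lintegral_congr fun s' => ?_
    congr 3
    ext j; fin_cases j <;> simp

/-- Gagliardo's inequality for `u^(k+1)` raises the exponent from `2k` to `2k + 2`. -/
theorem lintegral_pow_le_step_of_dim_two {u : (Fin 2 → ℝ) → ℝ} (hu : ContDiff ℝ 1 u)
    (huc : HasCompactSupport u) (k : ℕ) :
    ∫⁻ x, ‖u x‖ₑ ^ (2 * (k + 1)) ≤
      (k + 1) ^ 2 * (∫⁻ x, ‖u x‖ₑ ^ (2 * k)) * dirichletEnergy u := by
  have hc : HasCompactSupport fun y => u y ^ (k + 1) :=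
    huc.comp_left (g := fun t : ℝ => t ^ (k + 1)) (by simp)
  have h := lintegral_sq_le_mul_lintegral_partial_deriv (hu.pow (k + 1)) hc
  simp_rw [enorm_pow, ← pow_mul, mul_comm (k + 1) 2] at h
  have hsq : ∀ y : ℝ≥0∞, y ^ (1 / 2 : ℝ) * y ^ (1 / 2 : ℝ) = y := by
    intro y
    rw [← ENNReal.rpow_add_of_nonneg _ _ (by norm_num) (by norm_num)]
    norm_num
  refine (h.trans (mul_le_mul' (lintegral_partial_deriv_pow_le hu k 0)
    (lintegral_partial_deriv_pow_le hu k 1))).trans (le_of_eq ?_)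
  nth_rewrite 3 [← hsq (∫⁻ x, ‖u x‖ₑ ^ (2 * k))]
  nth_rewrite 3 [← hsq (dirichletEnergy u)]
  ring

/-- The even exponents in the plane, by iteration; the factors `(k+1)²` accumulate to the square of
a factorial. -/
theorem lintegral_pow_le_of_dim_two {u : (Fin 2 → ℝ) → ℝ} (hu : ContDiff ℝ 1 u)
    (huc : HasCompactSupport u) (k : ℕ) :
    ∫⁻ x, ‖u x‖ₑ ^ (2 * (k + 1)) ≤
      ((k + 1)! : ℝ≥0∞) ^ 2 * (∫⁻ x, ‖u x‖ₑ ^ 2) * dirichletEnergy u ^ k := by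
  induction k with
  | zero => simp
  | succ k ih =>
    refine (lintegral_pow_le_step_of_dim_two hu huc (k + 1)).trans ?_
    calc _ ≤ (((k + 1 : ℕ) : ℝ≥0∞) + 1) ^ 2 * (((k + 1)! : ℝ≥0∞) ^ 2 * (∫⁻ x, ‖u x‖ₑ ^ 2) *
          dirichletEnergy u ^ k) * dirichletEnergy u := by gcongr
      _ = _ := by
        rw [Nat.factorial_succ (k + 1)]
        push_cast
        ring

end DimensionTwo

/-! ### Gagliardo–Nirenberg inequalities for Lebesgue measure -/

/-- The Gagliardo–Nirenberg inequality with respect to Lebesgue measure, for compactly supported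
`C¹` functions. -/
def SmoothGagliardoNirenberg (n : ℕ) (p : ℝ≥0∞) (C : ℝ) : Prop :=
  ∀ u : (Fin n → ℝ) → ℝ, ContDiff ℝ 1 u → HasCompactSupport u →
    eLpNorm u p volume ≤ ENNReal.ofReal C * eLpNorm u 2 volume ^ gnExponent n p *
      (dirichletEnergy u ^ (1 / 2 : ℝ)) ^ (1 - gnExponent n p)

theorem eLpNorm_two_eq_lintegral {α F : Type*} [MeasurableSpace α] [NormedAddCommGroup F]
    {μ : Measure α} (f : α → F) : eLpNorm f 2 μ = (∫⁻ x, ‖f x‖ₑ ^ 2 ∂μ) ^ (1 / 2 : ℝ) := by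
  rw [eLpNorm_eq_lintegral_rpow_enorm_toReal two_ne_zero ENNReal.ofNat_ne_top]
  simp

/-- Dimension one: `∫ |u|^p ≤ ‖u‖_∞^(p-2) ∫ |u|²` and the pointwise bound for `|u|²`. -/
theorem smoothGagliardoNirenberg_one {p : ℝ≥0∞} (hp : 2 ≤ p) :
    SmoothGagliardoNirenberg 1 p ((2 : ℝ) ^ ((1 : ℝ) / 2 - (p⁻¹).toReal)) := by
  intro u hu huc
  have hpt := enorm_sq_le_of_dim_one hu huc
  rw [eLpNorm_two_eq_lintegral]
  set I := ∫⁻ x, ‖u x‖ₑ ^ 2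
  set E := dirichletEnergy u
  set M : ℝ≥0∞ := 2 * (I ^ (1 / 2 : ℝ) * E ^ (1 / 2 : ℝ)) with hM
  have hy1 : (p⁻¹).toReal ≤ 1 / 2 := by
    have := ENNReal.toReal_mono (by simp) (ENNReal.inv_le_inv.2 hp)
    simpa using this
  have hy0 : 0 ≤ (p⁻¹).toReal := ENNReal.toReal_nonneg
  -- both cases reduce to this bound
  have key : eLpNorm u p volume ≤ I ^ (p⁻¹).toReal * M ^ (1 / 2 - (p⁻¹).toReal) := by
    have hsqrt : ∀ x, ‖u x‖ₑ = (‖u x‖ₑ ^ 2) ^ (1 / 2 : ℝ) := by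
      intro x
      rw [← ENNReal.rpow_natCast, ← ENNReal.rpow_mul]
      norm_num
    rcases eq_or_ne p ⊤ with rfl | hpt'
    · simp only [ENNReal.inv_top, ENNReal.toReal_zero, ENNReal.rpow_zero, one_mul, sub_zero]
      rw [eLpNorm_exponent_top]
      refine eLpNormEssSup_le_of_ae_enorm_bound (ae_of_all _ fun x => ?_)
      rw [hsqrt x]
      exact ENNReal.rpow_le_rpow (hpt x) (by norm_num)
    · have hp2 : 2 ≤ p.toReal := by simpa using ENNReal.toReal_mono hpt' hp
      have hp0 : p ≠ 0 := (two_pos.trans_le hp).ne'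
      rw [eLpNorm_eq_lintegral_rpow_enorm_toReal hp0 hpt', ENNReal.toReal_inv]
      set r := p.toReal
      have h1 : ∫⁻ x, ‖u x‖ₑ ^ r ≤ I * M ^ ((r - 2) / 2) := by
        rw [← lintegral_mul_const _ (hu.continuous.measurable.enorm.pow_const 2)]
        refine lintegral_mono fun x => ?_
        calc ‖u x‖ₑ ^ r = ‖u x‖ₑ ^ 2 * (‖u x‖ₑ ^ 2) ^ ((r - 2) / 2) := by
              rw [← ENNReal.rpow_natCast, ← ENNReal.rpow_mul, ← ENNReal.rpow_add_of_nonneg]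
              · congr 1; push_cast; ring
              · norm_num
              · push_cast; linarith
          _ ≤ ‖u x‖ₑ ^ 2 * M ^ ((r - 2) / 2) := by
              gcongr
              exact hpt x
      refine (ENNReal.rpow_le_rpow h1 (by positivity)).trans (le_of_eq ?_)
      rw [ENNReal.mul_rpow_of_nonneg _ _ (by positivity), ← ENNReal.rpow_mul, one_div]
      congr 2
      field_simp
  refine key.trans (le_of_eq ?_)
  unfold gnExponent
  set y := (p⁻¹).toReal
  have hy : 0 ≤ 1 / 2 - y := by linarith
  rw [hM, ENNReal.mul_rpow_of_nonneg _ _ hy, ENNReal.mul_rpow_of_nonneg _ _ hy,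
    ← ENNReal.rpow_mul, ← ENNReal.rpow_mul, ← ENNReal.rpow_mul, ← ENNReal.rpow_mul,
    ← ENNReal.ofReal_rpow_of_pos two_pos, ENNReal.ofReal_ofNat]
  have e1 : 1 / 2 * (1 + ((1 : ℕ) : ℝ) * (y - 1 / 2)) = y + 1 / 2 * (1 / 2 - y) := by
    push_cast; ring
  have e2 : 1 / 2 * (1 - (1 + ((1 : ℕ) : ℝ) * (y - 1 / 2))) = 1 / 2 * (1 / 2 - y) := by
    push_cast; ring
  rw [e1, e2, ENNReal.rpow_add_of_nonneg _ _ hy0 (by positivity)]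
  ring

/-- Dimension two: interpolation between the even exponents `2k` and `2k + 2`. -/
theorem smoothGagliardoNirenberg_two {p : ℝ≥0∞} {k : ℕ} {r : ℝ} (hp : 2 ≤ p) (hpt : p < ⊤)
    (hk : 1 ≤ k) (hr0 : 0 ≤ r) (hr1 : r < 1) (hpk : p.toReal = 2 * ((k : ℝ) + r)) :
    SmoothGagliardoNirenberg 2 p
      (((k ! : ℕ) : ℝ) ^ (1 / ((k : ℝ) + r)) * ((k : ℝ) + 1) ^ (r / ((k : ℝ) + r))) := by
  intro u hu huc
  obtain ⟨m, rfl⟩ : ∃ m, k = m + 1 := ⟨k - 1, by omega⟩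
  have hp0 : p ≠ 0 := (two_pos.trans_le hp).ne'
  have hm0 : (0 : ℝ) ≤ m := Nat.cast_nonneg m
  rw [eLpNorm_two_eq_lintegral, eLpNorm_eq_lintegral_rpow_enorm_toReal hp0 hpt.ne, hpk]
  have h0 := lintegral_pow_le_of_dim_two hu huc m
  have h1 := lintegral_pow_le_of_dim_two hu huc (m + 1)
  set I := ∫⁻ x, ‖u x‖ₑ ^ 2
  set E := dirichletEnergy u
  set K : ℝ := ((m + 1 : ℕ) : ℝ) + r with hK
  have hK0 : 0 < K := by rw [hK]; push_cast; linarith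
  set A : ℝ≥0∞ := ((m + 1)! : ℝ≥0∞) with hA
  have hfac : ((m + 1 + 1)! : ℝ≥0∞) = A * ((m : ℝ≥0∞) + 1 + 1) := by
    rw [Nat.factorial_succ (m + 1), hA]
    push_cast
    ring
  set B : ℝ≥0∞ := (m : ℝ≥0∞) + 1 + 1
  -- interpolation between the exponents `2k` and `2k + 2`
  have hint : ∫⁻ x, ‖u x‖ₑ ^ (2 * K) ≤ A ^ (2 : ℝ) * B ^ (2 * r) * I * E ^ (K - 1) := by
    have h := lintegral_rpow_interpolate (μ := volume) (hu.continuous.measurable.enorm)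
      (r₀ := ((2 * (m + 1) : ℕ) : ℝ)) (r₁ := ((2 * (m + 1 + 1) : ℕ) : ℝ)) (by positivity)
      (by positivity) (sub_nonneg.2 hr1.le) hr0 (sub_add_cancel 1 r)
    have e : (1 - r) * ((2 * (m + 1) : ℕ) : ℝ) + r * ((2 * (m + 1 + 1) : ℕ) : ℝ) = 2 * K := by
      rw [hK]; push_cast; ring
    rw [e] at h
    simp only [ENNReal.rpow_natCast] at h
    have hs : 0 ≤ 1 - r := by linarith
    refine h.trans ((mul_le_mul' (ENNReal.rpow_le_rpow h0 hs)
      (ENNReal.rpow_le_rpow h1 hr0)).trans (le_of_eq ?_))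
    rw [hfac, mul_pow]
    simp only [ENNReal.mul_rpow_of_nonneg _ _ hs, ENNReal.mul_rpow_of_nonneg _ _ hr0,
      ← ENNReal.rpow_natCast, ← ENNReal.rpow_mul]
    have eA : A ^ (2 : ℝ) = A ^ (((2 : ℕ) : ℝ) * (1 - r)) * A ^ (((2 : ℕ) : ℝ) * r) := by
      rw [← ENNReal.rpow_add_of_nonneg _ _ (by positivity) (by positivity)]
      congr 1; push_cast; ring
    have eI : I = I ^ (1 - r) * I ^ r := by
      rw [← ENNReal.rpow_add_of_nonneg _ _ hs hr0]; simp
    have eE : E ^ (K - 1) = E ^ ((m : ℝ) * (1 - r)) * E ^ (((m + 1 : ℕ) : ℝ) * r) := by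
      rw [← ENNReal.rpow_add_of_nonneg _ _ (by positivity) (by positivity)]
      congr 1; rw [hK]; push_cast; ring
    rw [eA, eE]
    nth_rewrite 3 [eI]
    push_cast
    ring
  refine (ENNReal.rpow_le_rpow hint (by positivity)).trans (le_of_eq ?_)
  have hi : 0 ≤ 1 / (2 * K) := by positivity
  simp only [ENNReal.mul_rpow_of_nonneg _ _ hi, ← ENNReal.rpow_mul]
  have hpinv : (p⁻¹).toReal = 1 / (2 * K) := by rw [ENNReal.toReal_inv, hpk, one_div]
  unfold gnExponent
  rw [hpinv, ENNReal.ofReal_mul (by positivity),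
    ← ENNReal.ofReal_rpow_of_pos (by positivity), ← ENNReal.ofReal_rpow_of_pos (by positivity),
    ENNReal.ofReal_natCast, ENNReal.ofReal_add (by positivity) zero_le_one, ENNReal.ofReal_natCast,
    ENNReal.ofReal_one]
  have e1 : 2 * (1 / (2 * K)) = 1 / K := by field_simp
  have e2 : 2 * r * (1 / (2 * K)) = r / K := by field_simp
  have e3 : 1 / 2 * (1 + ((2 : ℕ) : ℝ) * (1 / (2 * K) - 1 / 2)) = 1 / (2 * K) := by
    push_cast; field_simp; ring
  have e4 : 1 / 2 * (1 - (1 + ((2 : ℕ) : ℝ) * (1 / (2 * K) - 1 / 2))) =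
      (K - 1) * (1 / (2 * K)) := by push_cast; field_simp; ring
  have hB : ((m + 1 : ℕ) : ℝ≥0∞) + 1 = B := by push_cast; rfl
  rw [e1, e2, e3, e4, hB]

theorem dirichletEnergy_eq_ofReal {n : ℕ} {u : (Fin n → ℝ) → ℝ} (hu : ContDiff ℝ 1 u)
    (huc : HasCompactSupport u) :
    dirichletEnergy u =
      ENNReal.ofReal (∫ x, ∑ i, fderiv ℝ u x (Pi.single i 1) ^ 2) := by
  rw [ofReal_integral_eq_lintegral_ofReal (integrable_sum_fderiv_sq hu huc)
    (ae_of_all _ fun x => Finset.sum_nonneg fun i _ => sq_nonneg _)]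
  refine lintegral_congr fun x => ?_
  rw [ENNReal.ofReal_sum_of_nonneg fun i _ => sq_nonneg _]
  refine Finset.sum_congr rfl fun i _ => ?_
  rw [Real.enorm_eq_ofReal_abs, ← ENNReal.ofReal_pow (abs_nonneg _), sq_abs]

/-- The best constant in the Sobolev inequality `‖u‖_{2n/(n-2)} ≤ S ‖∇u‖₂` on `ℝⁿ`. -/
noncomputable def sobolevConst (n : ℕ) : ℝ :=
  (1 / ((n : ℝ) * ((n : ℝ) - 2) * Real.pi)) ^ (1 / 2 : ℝ) *
    ((((n - 1) ! : ℕ) : ℝ) / Real.Gamma ((n : ℝ) / 2)) ^ (1 / (n : ℝ))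

/-- The sharp Sobolev inequality with the constant in closed form. -/
theorem lintegral_rpow_le_sobolevConst {n : ℕ} (hn : 3 ≤ n) {u : (Fin n → ℝ) → ℝ}
    (hu : ContDiff ℝ 1 u) (huc : HasCompactSupport u) :
    (∫⁻ x, ‖u x‖ₑ ^ (2 * (n : ℝ) / (n - 2))) ^ (((n : ℝ) - 2) / (2 * n)) ≤
      ENNReal.ofReal (sobolevConst n) * dirichletEnergy u ^ (1 / 2 : ℝ) := by
  have hn3 : (3 : ℝ) ≤ n := by exact_mod_cast hn
  have hn0 : (0 : ℝ) < n := by linarith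
  have hn2 : (0 : ℝ) < n - 2 := by linarith
  have h := sharp_sobolev_mass hn hu huc rfl
  rw [dirichletEnergy_eq_ofReal hu huc]
  set q := 2 * (n : ℝ) / (n - 2) with hq
  have hq0 : 0 < q := by positivity
  have hfi : Integrable fun x => |u x| ^ q :=
    (hu.continuous.abs.rpow_const fun x => Or.inr hq0.le).integrable_of_hasCompactSupport
      (huc.comp_left (g := fun t : ℝ => |t| ^ q) (by simp [Real.zero_rpow hq0.ne']))
  have hP : ∫⁻ x, ‖u x‖ₑ ^ q = ENNReal.ofReal (∫ x, |u x| ^ q) := by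
    rw [ofReal_integral_eq_lintegral_ofReal hfi (ae_of_all _ fun x =>
      Real.rpow_nonneg (abs_nonneg _) _)]
    refine lintegral_congr fun x => ?_
    rw [Real.enorm_eq_ofReal_abs, ENNReal.ofReal_rpow_of_nonneg (abs_nonneg _) hq0.le]
  rw [hP]
  have hP0 : 0 ≤ ∫ x, |u x| ^ q := integral_nonneg fun x => Real.rpow_nonneg (abs_nonneg _) _
  have hE0 : 0 ≤ ∫ x, ∑ i, fderiv ℝ u x (Pi.single i 1) ^ 2 :=
    integral_nonneg fun x => Finset.sum_nonneg fun i _ => sq_nonneg _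
  set P := ∫ x, |u x| ^ q
  set E := ∫ x, ∑ i, fderiv ℝ u x (Pi.single i 1) ^ 2
  have hfac : (((n - 1) ! : ℕ) : ℝ) = Real.Gamma n := by
    rw [← Real.Gamma_nat_eq_factorial, Nat.cast_sub (by omega)]
    simp
  have hΓ₁ : 0 < Real.Gamma ((n : ℝ) / 2) := Real.Gamma_pos_of_pos (by linarith)
  have hΓ₂ : 0 < Real.Gamma (n : ℝ) := Real.Gamma_pos_of_pos hn0
  set R := Real.Gamma (n : ℝ) / Real.Gamma ((n : ℝ) / 2) with hR
  have hR0 : 0 < R := div_pos hΓ₂ hΓ₁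
  have hS : sobolevConst n = (1 / ((n : ℝ) * (n - 2) * Real.pi)) ^ (1 / 2 : ℝ) *
      R ^ (1 / (n : ℝ)) := by rw [sobolevConst, hfac]
  have hS0 : 0 ≤ sobolevConst n := by rw [hS]; positivity
  have hZ : (Real.pi ^ ((n : ℝ) / 2) * Real.Gamma (n / 2) / Real.Gamma n) ^ (2 / (n : ℝ)) =
      Real.pi / R ^ (2 / (n : ℝ)) := by
    rw [mul_div_assoc, show Real.Gamma ((n : ℝ) / 2) / Real.Gamma n = R⁻¹ by rw [hR, inv_div],
      Real.mul_rpow (by positivity) (by positivity), ← Real.rpow_mul Real.pi_pos.le,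
      Real.inv_rpow hR0.le, show (n : ℝ) / 2 * (2 / n) = 1 by field_simp, Real.rpow_one]
    exact (div_eq_mul_inv _ _).symm
  have hS2 : sobolevConst n ^ 2 = R ^ (2 / (n : ℝ)) / (n * (n - 2) * Real.pi) := by
    rw [hS, mul_pow, ← Real.rpow_natCast, ← Real.rpow_mul (by positivity),
      ← Real.rpow_natCast (R ^ _), ← Real.rpow_mul hR0.le,
      show 1 / 2 * ((2 : ℕ) : ℝ) = 1 by norm_num, Real.rpow_one,
      show 1 / (n : ℝ) * ((2 : ℕ) : ℝ) = 2 / n by push_cast; ring]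
    ring
  have hmain : P ^ (1 - 2 / (n : ℝ)) ≤ sobolevConst n ^ 2 * E := by
    rw [hZ] at h
    rw [hS2, div_mul_eq_mul_div, le_div_iff₀ (by positivity)]
    have hRp : 0 < R ^ (2 / (n : ℝ)) := by positivity
    have e : P ^ (1 - 2 / (n : ℝ)) * (n * (n - 2) * Real.pi) = R ^ (2 / (n : ℝ)) *
        (P ^ (1 - 2 / (n : ℝ)) * (Real.pi / R ^ (2 / (n : ℝ))) * (n * (n - 2))) := by
      field_simp
    rw [e]
    exact mul_le_mul_of_nonneg_left h hRp.le
  rw [ENNReal.ofReal_rpow_of_nonneg hP0 (by positivity),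
    ENNReal.ofReal_rpow_of_nonneg hE0 (by norm_num), ← ENNReal.ofReal_mul hS0]
  apply ENNReal.ofReal_le_ofReal
  have h2 := Real.rpow_le_rpow (by positivity) hmain (by norm_num : (0 : ℝ) ≤ 1 / 2)
  rw [← Real.rpow_mul hP0, Real.mul_rpow (by positivity) hE0, ← Real.sqrt_eq_rpow (_ ^ 2),
    Real.sqrt_sq hS0] at h2
  convert! h2 using 2
  field_simp

/-- Dimension at least three: interpolation between `L²` and the Sobolev exponent `2n/(n-2)`. -/
theorem smoothGagliardoNirenberg_of_three_le {n : ℕ} (hn : 3 ≤ n) {p : ℝ≥0∞} (hp : 2 ≤ p)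
    (hpn : p ≤ ENNReal.ofReal (2 * (n : ℝ) / ((n : ℝ) - 2))) :
    SmoothGagliardoNirenberg n p
      ((1 / ((n : ℝ) * ((n : ℝ) - 2) * Real.pi)) ^ ((1 - gnExponent n p) / 2) *
        ((((n - 1) ! : ℕ) : ℝ) / Real.Gamma ((n : ℝ) / 2)) ^ ((1 : ℝ) / 2 - (p⁻¹).toReal)) := by
  intro u hu huc
  have hn3 : (3 : ℝ) ≤ n := by exact_mod_cast hn
  have hn0 : (0 : ℝ) < n := by linarith
  have hn2 : (0 : ℝ) < n - 2 := by linarith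
  have hΓ₁ : 0 < Real.Gamma ((n : ℝ) / 2) := Real.Gamma_pos_of_pos (by linarith)
  have hpt : p ≠ ⊤ := (hpn.trans_lt ENNReal.ofReal_lt_top).ne
  have hp0 : p ≠ 0 := (two_pos.trans_le hp).ne'
  have hr2 : 2 ≤ p.toReal := by simpa using ENNReal.toReal_mono hpt hp
  have hrq : p.toReal ≤ 2 * (n : ℝ) / (n - 2) := by
    have := ENNReal.toReal_mono ENNReal.ofReal_ne_top hpn
    rwa [ENNReal.toReal_ofReal (by positivity)] at this
  have hsob := lintegral_rpow_le_sobolevConst hn hu huc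
  have hyr : (p⁻¹).toReal = 1 / p.toReal := by rw [ENNReal.toReal_inv, one_div]
  have ha : gnExponent n p = 1 - n * (1 / 2 - 1 / p.toReal) := by
    rw [gnExponent, hyr]; ring
  rw [eLpNorm_two_eq_lintegral, eLpNorm_eq_lintegral_rpow_enorm_toReal hp0 hpt, hyr]
  set r := p.toReal with hr
  have hr0 : 0 < r := by linarith
  set q := 2 * (n : ℝ) / (n - 2) with hq
  have hq0 : 0 < q := by positivity
  set t := (n : ℝ) * (1 / 2 - 1 / r) with ht
  have ht0 : 0 ≤ t := by
    have : 1 / r ≤ 1 / 2 := one_div_le_one_div_of_le two_pos hr2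
    rw [ht]; exact mul_nonneg hn0.le (by linarith)
  have ht1 : t ≤ 1 := by
    have h1 : 1 / q ≤ 1 / r := one_div_le_one_div_of_le hr0 hrq
    have h2 : (n : ℝ) * (1 / 2 - 1 / q) = 1 := by rw [hq]; field_simp; ring
    rw [← h2, ht]
    exact mul_le_mul_of_nonneg_left (by linarith) hn0.le
  have hC : (1 / ((n : ℝ) * (n - 2) * Real.pi)) ^ ((1 - gnExponent n p) / 2) *
      ((((n - 1) ! : ℕ) : ℝ) / Real.Gamma ((n : ℝ) / 2)) ^ ((1 : ℝ) / 2 - 1 / r) =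
      sobolevConst n ^ t := by
    rw [sobolevConst, Real.mul_rpow (by positivity) (by positivity), ← Real.rpow_mul (by positivity),
      ← Real.rpow_mul (by positivity), ha]
    congr 2
    · ring
    · rw [ht]; field_simp
  have hS0 : 0 ≤ sobolevConst n := by unfold sobolevConst; positivity
  rw [hC, ha, sub_sub_cancel, ← ENNReal.ofReal_rpow_of_nonneg hS0 ht0]
  set I := ∫⁻ x, ‖u x‖ₑ ^ 2 with hI
  set Q := ∫⁻ x, ‖u x‖ₑ ^ q
  set E := dirichletEnergy u
  have hint : ∫⁻ x, ‖u x‖ₑ ^ r ≤ I ^ ((1 - t) * r / 2) * Q ^ (t * r / q) := by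
    have hsum : (1 - t) * r / 2 + t * r / q = 1 := by
      rw [ht, hq]; field_simp; ring
    have h := lintegral_rpow_interpolate (μ := volume) (hu.continuous.measurable.enorm)
      (r₀ := ((2 : ℕ) : ℝ)) (r₁ := q) (by positivity) hq0.le
      (div_nonneg (mul_nonneg (sub_nonneg.2 ht1) hr0.le) two_pos.le)
      (div_nonneg (mul_nonneg ht0 hr0.le) hq0.le) hsum
    have e : (1 - t) * r / 2 * ((2 : ℕ) : ℝ) + t * r / q * q = r := by
      push_cast; field_simp; ring
    rw [e] at h
    simpa only [ENNReal.rpow_natCast] using h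
  calc (∫⁻ x, ‖u x‖ₑ ^ r) ^ (1 / r) ≤ (I ^ ((1 - t) * r / 2) * Q ^ (t * r / q)) ^ (1 / r) :=
        ENNReal.rpow_le_rpow hint (by positivity)
    _ = (I ^ (1 / 2 : ℝ)) ^ (1 - t) * (Q ^ (((n : ℝ) - 2) / (2 * n))) ^ t := by
        rw [ENNReal.mul_rpow_of_nonneg _ _ (by positivity), ← ENNReal.rpow_mul,
          ← ENNReal.rpow_mul, ← ENNReal.rpow_mul, ← ENNReal.rpow_mul]
        congr 2
        · field_simp
        · rw [hq]; field_simp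
    _ ≤ (I ^ (1 / 2 : ℝ)) ^ (1 - t) * (ENNReal.ofReal (sobolevConst n) * E ^ (1 / 2 : ℝ)) ^ t :=
        mul_le_mul_right (ENNReal.rpow_le_rpow hsob ht0) _
    _ = _ := by
        rw [ENNReal.mul_rpow_of_nonneg _ _ ht0]
        ring

/-! ### The weight `e^θ` -/

theorem continuous_theta {d : ℕ} : Continuous (theta (d := d)) := by
  unfold theta; fun_prop

theorem theta_nonneg {d : ℕ} (x : EuclideanSpace ℝ (Fin d)) : 0 ≤ theta x := by
  unfold theta; positivity

theorem measurable_ofReal_exp_theta {d : ℕ} :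
    Measurable fun x : EuclideanSpace ℝ (Fin d) => ENNReal.ofReal (Real.exp (theta x)) :=
  (Real.continuous_exp.comp continuous_theta).measurable.ennreal_ofReal

theorem expThetaMeasure_absolutelyContinuous (d : ℕ) : expThetaMeasure d ≪ volume :=
  withDensity_absolutelyContinuous _ _

theorem absolutelyContinuous_expThetaMeasure (d : ℕ) :
    (volume : Measure (EuclideanSpace ℝ (Fin d))) ≪ expThetaMeasure d :=
  withDensity_absolutelyContinuous' measurable_ofReal_exp_theta.aemeasurable
    (ae_of_all _ fun _ => (ENNReal.ofReal_pos.2 (Real.exp_pos _)).ne')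

theorem lintegral_expThetaMeasure {d : ℕ} (f : EuclideanSpace ℝ (Fin d) → ℝ≥0∞) :
    ∫⁻ x, f x ∂(expThetaMeasure d) = ∫⁻ x, ENNReal.ofReal (Real.exp (theta x)) * f x :=
  lintegral_withDensity_eq_lintegral_mul_non_measurable _ measurable_ofReal_exp_theta
    (ae_of_all _ fun _ => ENNReal.ofReal_lt_top) f

/-- Multiplication by `e^(θ/2)` turns the weighted norms into Lebesgue norms. -/
theorem eLpNorm_exp_theta_mul {d : ℕ} {p : ℝ≥0∞} (hp : p ≠ 0) (u : EuclideanSpace ℝ (Fin d) → ℝ) :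
    eLpNorm (fun x => Real.exp ((1 / 2 - (p⁻¹).toReal) * theta x) * u x) p (expThetaMeasure d) =
      eLpNorm (fun x => Real.exp (theta x / 2) * u x) p volume := by
  rcases eq_or_ne p ⊤ with rfl | hpt
  · have h : (fun x => Real.exp ((1 / 2 - ((⊤ : ℝ≥0∞)⁻¹).toReal) * theta x) * u x) =
        fun x => Real.exp (theta x / 2) * u x := by
      funext x
      simp only [ENNReal.inv_top, ENNReal.toReal_zero, sub_zero]
      ring_nf
    rw [h, eLpNorm_exponent_top, eLpNorm_exponent_top]
    exact le_antisymm (eLpNormEssSup_mono_measure _ (expThetaMeasure_absolutelyContinuous d))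
      (eLpNormEssSup_mono_measure _ (absolutelyContinuous_expThetaMeasure d))
  · have hr : 0 < p.toReal := ENNReal.toReal_pos hp hpt
    rw [eLpNorm_eq_lintegral_rpow_enorm_toReal hp hpt, eLpNorm_eq_lintegral_rpow_enorm_toReal hp hpt,
      lintegral_expThetaMeasure, ENNReal.toReal_inv]
    congr 1
    refine lintegral_congr fun x => ?_
    rw [enorm_mul, enorm_mul, ENNReal.mul_rpow_of_nonneg _ _ hr.le,
      ENNReal.mul_rpow_of_nonneg _ _ hr.le, ← mul_assoc]
    congr 1
    rw [Real.enorm_eq_ofReal (Real.exp_pos _).le, Real.enorm_eq_ofReal (Real.exp_pos _).le,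
      ENNReal.ofReal_rpow_of_pos (Real.exp_pos _), ENNReal.ofReal_rpow_of_pos (Real.exp_pos _),
      ← ENNReal.ofReal_mul (Real.exp_pos _).le, ← Real.exp_mul, ← Real.exp_mul, ← Real.exp_add]
    congr 2
    field_simp
    ring

/-- Expanding the square and integrating by parts, `∫ |∇w - (x/4) w|²` exceeds `∫ |∇w|²` by
`∫ |x|² w² / 16 + (n/4) ∫ w²`. -/
theorem integral_sum_fderiv_sq_le {n : ℕ} {w : (Fin n → ℝ) → ℝ} (hw : ContDiff ℝ 1 w)
    (hwc : HasCompactSupport w) :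
    ∫ x, ∑ i, fderiv ℝ w x (Pi.single i 1) ^ 2 ≤
      ∫ x, ∑ i, (fderiv ℝ w x (Pi.single i 1) - x i / 4 * w x) ^ 2 := by
  have hd := hw.continuous_fderiv_single
  have hx : ∀ i : Fin n, Continuous fun x : Fin n → ℝ => x i := fun i => continuous_apply i
  have hint : ∀ f : (Fin n → ℝ) → ℝ, Continuous f → Integrable fun x => f x * w x := fun f hf =>
    (hf.mul hw.continuous).integrable_of_hasCompactSupport hwc.mul_left
  have i1 := integrable_fderiv_single_sq hw hwc
  have i2 : ∀ i, Integrable fun x => x i * fderiv ℝ w x (Pi.single i 1) * w x :=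
    fun i => hint _ ((hx i).mul (hd i))
  have hcross : ∀ i, ∫ x, x i * fderiv ℝ w x (Pi.single i 1) * w x = -(1 / 2) * ∫ x, w x * w x := by
    intro i
    have hfd : ∀ x, fderiv ℝ (fun y : Fin n → ℝ => y i * w y) x (Pi.single i 1) =
        w x + x i * fderiv ℝ w x (Pi.single i 1) := by
      intro x
      have h1 : HasFDerivAt (fun y : Fin n → ℝ => y i)
          (ContinuousLinearMap.proj i : (Fin n → ℝ) →L[ℝ] ℝ) x := hasFDerivAt_apply i x
      have h2 := (h1.mul (hw.differentiable one_ne_zero x).hasFDerivAt).fderiv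
      have h2' : fderiv ℝ (fun y : Fin n → ℝ => y i * w y) x = _ := h2
      rw [h2']
      simp
      ring
    have hibp := integral_mul_fderiv_eq_neg_fderiv_mul_of_integrable (μ := volume)
      (f := fun y : Fin n → ℝ => y i * w y) (g := w) (v := Pi.single i 1) ?_ ?_ ?_ ?_ ?_
    · simp_rw [hfd, add_mul] at hibp
      rw [integral_add (hint _ hw.continuous) (i2 i)] at hibp
      have e : ∫ x, x i * w x * fderiv ℝ w x (Pi.single i 1) =
          ∫ x, x i * fderiv ℝ w x (Pi.single i 1) * w x :=
        integral_congr_ae (ae_of_all _ fun x => by ring)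
      rw [e] at hibp
      linarith
    · simp_rw [hfd]
      exact hint _ (hw.continuous.add ((hx i).mul (hd i)))
    · refine (i2 i).congr (ae_of_all _ fun x => ?_)
      simp only
      ring
    · exact hint _ ((hx i).mul hw.continuous)
    · exact fun x _ => (differentiableAt_apply i x).mul (hw.differentiable one_ne_zero x)
    · exact fun x _ => hw.differentiable one_ne_zero x
  have i3 : ∀ i : Fin n, Integrable fun x : Fin n → ℝ => x i ^ 2 * w x * w x :=
    fun i => hint _ (((hx i).pow 2).mul hw.continuous)
  have hsplit : ∀ (x : Fin n → ℝ) (i : Fin n), (fderiv ℝ w x (Pi.single i 1) - x i / 4 * w x) ^ 2 =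
      fderiv ℝ w x (Pi.single i 1) ^ 2 + (1 / 16 * (x i ^ 2 * w x * w x) +
        -(1 / 2) * (x i * fderiv ℝ w x (Pi.single i 1) * w x)) := fun x i => by ring
  simp_rw [hsplit]
  have i4 : ∀ i : Fin n, Integrable fun x => 1 / 16 * (x i ^ 2 * w x * w x) +
      -(1 / 2) * (x i * fderiv ℝ w x (Pi.single i 1) * w x) :=
    fun i => ((i3 i).const_mul _).add ((i2 i).const_mul _)
  have i5 : ∀ i : Fin n, Integrable fun x => fderiv ℝ w x (Pi.single i 1) ^ 2 +
      (1 / 16 * (x i ^ 2 * w x * w x) +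
        -(1 / 2) * (x i * fderiv ℝ w x (Pi.single i 1) * w x)) := fun i => (i1 i).add (i4 i)
  rw [integral_finsetSum _ fun i _ => i1 i, integral_finsetSum _ fun i _ => i5 i]
  refine Finset.sum_le_sum fun i _ => ?_
  have e1 : ∫ x, (fderiv ℝ w x (Pi.single i 1) ^ 2 + (1 / 16 * (x i ^ 2 * w x * w x) +
        -(1 / 2) * (x i * fderiv ℝ w x (Pi.single i 1) * w x))) =
      (∫ x, fderiv ℝ w x (Pi.single i 1) ^ 2) + (1 / 16 * (∫ x, x i ^ 2 * w x * w x) +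
        -(1 / 2) * (-(1 / 2) * ∫ x, w x * w x)) := by
    rw [integral_add (i1 i) (i4 i), integral_add ((i3 i).const_mul _) ((i2 i).const_mul _),
      integral_const_mul, integral_const_mul, hcross i]
  rw [e1]
  have p1 : 0 ≤ ∫ x : Fin n → ℝ, x i ^ 2 * w x * w x :=
    integral_nonneg fun x => by
      have : x i ^ 2 * w x * w x = (x i * w x) ^ 2 := by ring
      simp only [Pi.zero_apply, this]
      positivity
  have p2 : 0 ≤ ∫ x, w x * w x := integral_nonneg fun x => mul_self_nonneg _
  linarith

/-- The Dirichlet integral of `e^(θ/2) η` for Lebesgue measure is at most that of `η` for the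
weighted measure; `γ` is the gradient of `η`. -/
theorem dirichletEnergy_exp_theta_mul_le {d : ℕ} {η : EuclideanSpace ℝ (Fin d) → ℝ}
    (hη : ContDiff ℝ 1 η) (hηc : HasCompactSupport η)
    {γ : EuclideanSpace ℝ (Fin d) → EuclideanSpace ℝ (Fin d)}
    (hγ : ∀ x i, γ x i = fderiv ℝ η x (EuclideanSpace.single i 1)) :
    dirichletEnergy (fun x => Real.exp (theta (WithLp.toLp 2 x) / 2) * η (WithLp.toLp 2 x)) ≤
      ∫⁻ x, ‖γ x‖ₑ ^ 2 ∂(expThetaMeasure d) := by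
  set e : (Fin d → ℝ) ≃L[ℝ] EuclideanSpace ℝ (Fin d) := (EuclideanSpace.equiv (Fin d) ℝ).symm
  have he : ∀ x, e x = WithLp.toLp 2 x := fun x => rfl
  have hsingle : ∀ i, e (Pi.single i 1) = EuclideanSpace.single i 1 := fun i => by
    rw [he]; simp
  set h : (Fin d → ℝ) → ℝ := fun x => Real.exp ((∑ i, x i ^ 2) / 8) with hh
  have hexp : ∀ x : Fin d → ℝ, Real.exp (theta (WithLp.toLp 2 x) / 2) = h x := by
    intro x
    simp only [hh, theta, EuclideanSpace.norm_sq_eq, Real.norm_eq_abs, sq_abs]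
    ring_nf
  set w : (Fin d → ℝ) → ℝ := fun x => h x * η (e x) with hw
  have hwe : (fun x => Real.exp (theta (WithLp.toLp 2 x) / 2) * η (WithLp.toLp 2 x)) = w := by
    funext x
    simp only [hw, hexp, he]
  rw [hwe]
  have hhd : ContDiff ℝ 1 h := by
    simp only [hh]
    fun_prop
  have hηe : ContDiff ℝ 1 fun x => η (e x) := hη.comp e.contDiff
  have hwd : ContDiff ℝ 1 w := hhd.mul hηe
  have hηec : HasCompactSupport fun x => η (e x) := hηc.comp_homeomorph e.toHomeomorph
  have hwc : HasCompactSupport w := hηec.mul_left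
  have hderiv : ∀ x i, fderiv ℝ w x (Pi.single i 1) - x i / 4 * w x = h x * γ (e x) i := by
    intro x i
    have h1 : HasFDerivAt h (h x • ((8 : ℝ)⁻¹ • ∑ j, (2 * x j) •
        (ContinuousLinearMap.proj j : (Fin d → ℝ) →L[ℝ] ℝ))) x := by
      have h2 : HasFDerivAt (fun y : Fin d → ℝ => (∑ j, y j ^ 2) * (8 : ℝ)⁻¹)
          ((8 : ℝ)⁻¹ • ∑ j, (2 * x j) •
            (ContinuousLinearMap.proj j : (Fin d → ℝ) →L[ℝ] ℝ)) x := by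
        refine HasFDerivAt.mul_const (HasFDerivAt.fun_sum fun j _ => ?_) _
        have := (hasFDerivAt_apply (𝕜 := ℝ) j x).pow 2
        convert! this using 1
        simp
      exact h2.exp
    have h3 : HasFDerivAt (fun y => η (e y)) ((fderiv ℝ η (e x)).comp (e : (Fin d → ℝ) →L[ℝ] _)) x :=
      ((hη.differentiable one_ne_zero (e x)).hasFDerivAt).comp x e.hasFDerivAt
    have h4 : fderiv ℝ w x = _ := (h1.mul h3).fderiv
    rw [h4, hγ, ← hsingle]
    simp [hw, Pi.single_apply]
    ring
  rw [dirichletEnergy_eq_ofReal hwd hwc]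
  refine (ENNReal.ofReal_le_ofReal (integral_sum_fderiv_sq_le hwd hwc)).trans (le_of_eq ?_)
  simp_rw [hderiv]
  have hγc : ∀ i, Continuous fun x => γ (e x) i := by
    intro i
    simp_rw [hγ]
    exact ((hη.continuous_fderiv one_ne_zero).comp e.continuous).clm_apply continuous_const
  have hγs : ∀ i, HasCompactSupport fun x => γ (e x) i := by
    intro i
    have h1 : HasCompactSupport fun x => fderiv ℝ η x (EuclideanSpace.single i 1) :=
      hηc.fderiv_apply (𝕜 := ℝ) _
    simp_rw [hγ]
    exact h1.comp_homeomorph e.toHomeomorph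
  have hi : Integrable fun x => ∑ i, (h x * γ (e x) i) ^ 2 := by
    refine integrable_finsetSum _ fun i _ => ?_
    have h1 : HasCompactSupport fun x => h x * γ (e x) i := (hγs i).mul_left
    have h2 : HasCompactSupport fun x => (h x * γ (e x) i) ^ 2 :=
      h1.comp_left (g := fun t : ℝ => t ^ 2) (by simp)
    exact ((hhd.continuous.mul (hγc i)).pow 2).integrable_of_hasCompactSupport h2
  rw [ofReal_integral_eq_lintegral_ofReal hi (ae_of_all _ fun x =>
    Finset.sum_nonneg fun i _ => sq_nonneg _), lintegral_expThetaMeasure,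
    ← (PiLp.volume_preserving_toLp (Fin d)).lintegral_comp_emb
      (MeasurableEquiv.toLp 2 (Fin d → ℝ)).measurableEmbedding]
  refine lintegral_congr fun x => ?_
  rw [← he, ← ofReal_norm, ← ENNReal.ofReal_pow (norm_nonneg _),
    ← ENNReal.ofReal_mul (Real.exp_pos _).le, EuclideanSpace.norm_sq_eq]
  congr 1
  have h2 : Real.exp (theta (e x)) = h x ^ 2 := by
    rw [← hexp, ← Real.exp_nat_mul, he]
    congr 1
    push_cast
    ring
  rw [h2, Finset.mul_sum]
  refine Finset.sum_congr rfl fun i _ => ?_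
  rw [mul_pow, Real.norm_eq_abs, sq_abs]

/-- The weighted inequality for smooth functions: substitute `e^(θ/2) η` into the unweighted one. -/
theorem weighted_of_smoothGagliardoNirenberg {d : ℕ} {p : ℝ≥0∞} {C : ℝ} (hp : p ≠ 0)
    (ha : gnExponent d p ≤ 1) (h : SmoothGagliardoNirenberg d p C)
    {η : EuclideanSpace ℝ (Fin d) → ℝ} (hη : ContDiff ℝ 1 η) (hηc : HasCompactSupport η)
    {γ : EuclideanSpace ℝ (Fin d) → EuclideanSpace ℝ (Fin d)}
    (hγ : ∀ x i, γ x i = fderiv ℝ η x (EuclideanSpace.single i 1)) :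
    eLpNorm (fun x => Real.exp ((1 / 2 - (p⁻¹).toReal) * theta x) * η x) p (expThetaMeasure d) ≤
      ENNReal.ofReal C * eLpNorm η 2 (expThetaMeasure d) ^ gnExponent d p *
        eLpNorm γ 2 (expThetaMeasure d) ^ (1 - gnExponent d p) := by
  have htrans : ∀ q : ℝ≥0∞, eLpNorm (fun x => Real.exp (theta x / 2) * η x) q volume =
      eLpNorm (fun x => Real.exp (theta (WithLp.toLp 2 x) / 2) * η (WithLp.toLp 2 x)) q volume := by
    intro q
    have hm : AEStronglyMeasurable (fun x => Real.exp (theta x / 2) * η x) volume := by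
      have h1 : Continuous fun x : EuclideanSpace ℝ (Fin d) => Real.exp (theta x / 2) :=
        Real.continuous_exp.comp (continuous_theta.div_const 2)
      exact (h1.mul hη.continuous).aestronglyMeasurable
    exact (eLpNorm_comp_measurePreserving hm (PiLp.volume_preserving_toLp (Fin d))).symm
  have h2 : eLpNorm η 2 (expThetaMeasure d) =
      eLpNorm (fun x => Real.exp (theta x / 2) * η x) 2 volume := by
    rw [← eLpNorm_exp_theta_mul two_ne_zero]
    congr 1
    funext x
    simp
  have hcont : ContDiff ℝ 1 fun x : Fin d → ℝ =>
      Real.exp (theta (WithLp.toLp 2 x) / 2) * η (WithLp.toLp 2 x) := by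
    have h1 : ContDiff ℝ 1 fun x : EuclideanSpace ℝ (Fin d) => Real.exp (theta x / 2) * η x := by
      unfold theta
      exact (((contDiff_norm_sq ℝ).div_const 4).div_const 2).exp.mul hη
    exact h1.comp (EuclideanSpace.equiv (Fin d) ℝ).symm.contDiff
  have hcomp : HasCompactSupport fun x : Fin d → ℝ =>
      Real.exp (theta (WithLp.toLp 2 x) / 2) * η (WithLp.toLp 2 x) := by
    have h1 : HasCompactSupport fun x : Fin d → ℝ => η (WithLp.toLp 2 x) :=
      hηc.comp_homeomorph (EuclideanSpace.equiv (Fin d) ℝ).symm.toHomeomorph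
    exact h1.mul_left
  rw [eLpNorm_exp_theta_mul hp, h2, htrans, htrans]
  refine (h _ hcont hcomp).trans ?_
  gcongr
  · rw [eLpNorm_two_eq_lintegral]
    exact ENNReal.rpow_le_rpow (dirichletEnergy_exp_theta_mul_le hη hηc hγ) (by norm_num)

/-! ### Mollification in weighted spaces -/

section Mollification

variable {d : ℕ}

/-- Jensen's inequality for the square and a probability density `ρ`. -/
theorem lintegral_mul_sq_le_of_lintegral_eq_one {α : Type*} [MeasurableSpace α] {μ : Measure α}
    {ρ h : α → ℝ≥0∞} (hρ : AEMeasurable ρ μ) (hh : AEMeasurable h μ) (h1 : ∫⁻ x, ρ x ∂μ = 1) :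
    (∫⁻ x, ρ x * h x ∂μ) ^ 2 ≤ ∫⁻ x, ρ x * h x ^ 2 ∂μ := by
  have h2 := ENNReal.lintegral_mul_norm_pow_le hρ (hρ.mul (hh.pow_const 2)) (p := 1 / 2)
    (q := 1 / 2) (by norm_num) (by norm_num) (by norm_num)
  simp only [Pi.mul_apply] at h2
  rw [h1, ENNReal.one_rpow, one_mul] at h2
  have h3 : ∀ x, ρ x * h x = ρ x ^ (1 / 2 : ℝ) * (ρ x * h x ^ 2) ^ (1 / 2 : ℝ) := by
    intro x
    rw [ENNReal.mul_rpow_of_nonneg _ _ (by norm_num), ← mul_assoc,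
      ← ENNReal.rpow_add_of_nonneg _ _ (by norm_num) (by norm_num), ← ENNReal.rpow_natCast,
      ← ENNReal.rpow_mul]
    norm_num
  simp_rw [h3]
  refine (pow_le_pow_left' h2 2).trans (le_of_eq ?_)
  rw [← ENNReal.rpow_natCast, ← ENNReal.rpow_mul]
  norm_num

/-- Convolution with a probability density supported in a small ball increases the weighted `L²`
norm of a function supported in the ball of radius `R` by at most a factor close to `1`. -/
theorem lintegral_convolution_sq_le {F : Type*} [NormedAddCommGroup F] [NormedSpace ℝ F]
    {ρ : EuclideanSpace ℝ (Fin d) → ℝ} (hρ : Continuous ρ) (hρ0 : ∀ x, 0 ≤ ρ x)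
    (hρ1 : ∫⁻ x, ENNReal.ofReal (ρ x) = 1) {ε R : ℝ} (hR : 0 ≤ R)
    (hρs : ∀ x, ε < ‖x‖ → ρ x = 0) {f : EuclideanSpace ℝ (Fin d) → F}
    (hf : AEStronglyMeasurable f volume) (hfs : ∀ x, R < ‖x‖ → f x = 0) :
    ∫⁻ x, ‖convolution ρ f (ContinuousLinearMap.lsmul ℝ ℝ) volume x‖ₑ ^ 2 ∂(expThetaMeasure d) ≤
      ENNReal.ofReal (Real.exp ((2 * R * ε + ε ^ 2) / 4)) *
        ∫⁻ x, ‖f x‖ₑ ^ 2 ∂(expThetaMeasure d) := by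
  have hρm : Measurable fun t => ENNReal.ofReal (ρ t) := hρ.measurable.ennreal_ofReal
  have hpt : ∀ x, ‖convolution ρ f (ContinuousLinearMap.lsmul ℝ ℝ) volume x‖ₑ ^ 2 ≤
      ∫⁻ t, ENNReal.ofReal (ρ t) * ‖f (x - t)‖ₑ ^ 2 := by
    intro x
    have hm : AEMeasurable fun t => ‖f (x - t)‖ₑ :=
      (hf.comp_quasiMeasurePreserving
        (quasiMeasurePreserving_sub_left_of_right_invariant volume x)).enorm
    refine le_trans (pow_le_pow_left' ?_ 2)
      (lintegral_mul_sq_le_of_lintegral_eq_one hρm.aemeasurable hm hρ1)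
    rw [convolution_def]
    refine (enorm_integral_le_lintegral_enorm _).trans (le_of_eq (lintegral_congr fun t => ?_))
    rw [ContinuousLinearMap.lsmul_apply, enorm_smul, Real.enorm_eq_ofReal (hρ0 t)]
  have hjm : AEMeasurable (fun p : EuclideanSpace ℝ (Fin d) × EuclideanSpace ℝ (Fin d) =>
      ‖f (p.1 - p.2)‖ₑ) (volume.prod volume) :=
    (hf.comp_quasiMeasurePreserving
      (quasiMeasurePreserving_sub_of_right_invariant volume volume)).enorm
  have hθm := measurable_ofReal_exp_theta (d := d)
  calc ∫⁻ x, ‖convolution ρ f (ContinuousLinearMap.lsmul ℝ ℝ) volume x‖ₑ ^ 2 ∂(expThetaMeasure d)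
      ≤ ∫⁻ x, (∫⁻ t, ENNReal.ofReal (ρ t) * ‖f (x - t)‖ₑ ^ 2) ∂(expThetaMeasure d) :=
        lintegral_mono hpt
    _ = ∫⁻ x, ∫⁻ t, ENNReal.ofReal (Real.exp (theta x)) *
          (ENNReal.ofReal (ρ t) * ‖f (x - t)‖ₑ ^ 2) := by
        rw [lintegral_expThetaMeasure]
        exact lintegral_congr fun x => (lintegral_const_mul' _ _ ENNReal.ofReal_ne_top).symm
    _ = ∫⁻ t, ∫⁻ x, ENNReal.ofReal (Real.exp (theta x)) *
          (ENNReal.ofReal (ρ t) * ‖f (x - t)‖ₑ ^ 2) := by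
        refine lintegral_lintegral_swap ?_
        exact (hθm.comp measurable_fst).aemeasurable.mul
          ((hρm.comp measurable_snd).aemeasurable.mul (hjm.pow_const 2))
    _ ≤ ∫⁻ t, ENNReal.ofReal (ρ t) * (ENNReal.ofReal (Real.exp ((2 * R * ε + ε ^ 2) / 4)) *
          ∫⁻ x, ‖f x‖ₑ ^ 2 ∂(expThetaMeasure d)) := by
        refine lintegral_mono fun t => ?_
        have hshift : ∫⁻ x, ENNReal.ofReal (Real.exp (theta x)) *
            (ENNReal.ofReal (ρ t) * ‖f (x - t)‖ₑ ^ 2) =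
            ENNReal.ofReal (ρ t) * ∫⁻ y, ENNReal.ofReal (Real.exp (theta (y + t))) *
              ‖f y‖ₑ ^ 2 := by
          rw [← lintegral_const_mul' _ _ ENNReal.ofReal_ne_top]
          refine (lintegral_add_right_eq_self (fun x => ENNReal.ofReal (Real.exp (theta x)) *
            (ENNReal.ofReal (ρ t) * ‖f (x - t)‖ₑ ^ 2)) t).symm.trans (lintegral_congr fun y => ?_)
          rw [add_sub_cancel_right]
          ring
        simp only
        rw [hshift]
        rcases lt_or_ge ε ‖t‖ with ht | ht
        · simp [hρs t ht]
        · gcongr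
          rw [lintegral_expThetaMeasure, ← lintegral_const_mul' _ _ ENNReal.ofReal_ne_top]
          refine lintegral_mono fun y => ?_
          rcases lt_or_ge R ‖y‖ with hy | hy
          · simp [hfs y hy]
          · rw [← mul_assoc, ← ENNReal.ofReal_mul (Real.exp_pos _).le, ← Real.exp_add]
            gcongr
            have h1 : ‖y + t‖ ^ 2 ≤ (‖y‖ + ‖t‖) ^ 2 :=
              pow_le_pow_left₀ (norm_nonneg _) (norm_add_le y t) 2
            have h2 : ‖y‖ * ‖t‖ ≤ R * ε := mul_le_mul hy ht (norm_nonneg _) hR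
            have h3 : ‖t‖ ^ 2 ≤ ε ^ 2 := pow_le_pow_left₀ (norm_nonneg _) ht 2
            unfold theta
            nlinarith
    _ = _ := by
        rw [lintegral_mul_const _ hρm, hρ1, one_mul]

/-- Mollification commutes with the weak gradient. -/
theorem convolution_weakGradient_apply {u : EuclideanSpace ℝ (Fin d) → ℝ}
    {g : EuclideanSpace ℝ (Fin d) → EuclideanSpace ℝ (Fin d)} (h : HasWeakGradient u g)
    {ρ : EuclideanSpace ℝ (Fin d) → ℝ} (hρ : ContDiff ℝ ∞ ρ) (hρc : HasCompactSupport ρ)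
    (x : EuclideanSpace ℝ (Fin d)) (i : Fin d) :
    convolution ρ g (ContinuousLinearMap.lsmul ℝ ℝ) volume x i =
      fderiv ℝ (convolution ρ u (ContinuousLinearMap.lsmul ℝ ℝ) volume) x
        (EuclideanSpace.single i 1) := by
  obtain ⟨hu, hg, hug⟩ := h
  have hρ1 : ContDiff ℝ 1 ρ := hρ.of_le (by exact_mod_cast le_top)
  rw [(hρc.hasFDerivAt_convolution_left (ContinuousLinearMap.lsmul ℝ ℝ) hρ1 hu x).fderiv]
  have hint := (hρc.fderiv ℝ).convolutionExists_left
    ((ContinuousLinearMap.lsmul ℝ ℝ).precompL (EuclideanSpace ℝ (Fin d)))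
    (hρ1.continuous_fderiv one_ne_zero) hu x
  have hintg := hρc.convolutionExists_left (ContinuousLinearMap.lsmul ℝ ℝ) hρ.continuous hg x
  -- test the weak gradient against `y ↦ ρ (x - y)`
  have hsub : ContDiff ℝ ∞ fun y : EuclideanSpace ℝ (Fin d) => x - y :=
    contDiff_const.sub contDiff_id
  have htest := hug (fun y => ρ (x - y)) (hρ.comp hsub)
    (hρc.comp_homeomorph (Homeomorph.subLeft x)) i
  have hfd : ∀ y, fderiv ℝ (fun y => ρ (x - y)) y (EuclideanSpace.single i 1) =
      -fderiv ℝ ρ (x - y) (EuclideanSpace.single i 1) := by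
    intro y
    have h1 : HasFDerivAt (fun y : EuclideanSpace ℝ (Fin d) => x - y)
        (-ContinuousLinearMap.id ℝ (EuclideanSpace ℝ (Fin d))) y := by
      simpa using (hasFDerivAt_id y).const_sub x
    have h2 := ((hρ1.differentiable one_ne_zero (x - y)).hasFDerivAt.comp y h1).fderiv
    have h2' : fderiv ℝ (fun y => ρ (x - y)) y = _ := h2
    rw [h2']
    simp
  have hleft : convolution ρ g (ContinuousLinearMap.lsmul ℝ ℝ) volume x i =
      ∫ y, g y i * ρ (x - y) := by
    have h1 := (EuclideanSpace.proj (𝕜 := ℝ) i : EuclideanSpace ℝ (Fin d) →L[ℝ] ℝ).integral_comp_comm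
      hintg
    rw [convolution_def]
    refine Eq.trans h1.symm ?_
    rw [← integral_sub_left_eq_self _ volume x]
    refine integral_congr_ae (ae_of_all _ fun y => ?_)
    simp [mul_comm]
  rw [hleft, convolution_def, ContinuousLinearMap.integral_apply hint]
  simp_rw [hfd, mul_neg, integral_neg, neg_inj] at htest
  rw [← htest, ← integral_sub_left_eq_self _ volume x]
  refine integral_congr_ae (ae_of_all _ fun y => ?_)
  simp [ContinuousLinearMap.precompL_apply, mul_comm]

end Mollification

section Approximation

variable {d : ℕ}

/-- The inequality passes to limits: by Fatou's lemma it suffices that `uₖ → u` almost everywhere,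
together with upper bounds for the two norms on the right. -/
theorem eLpNorm_le_of_tendsto_ae {u : EuclideanSpace ℝ (Fin d) → ℝ}
    {v : ℕ → EuclideanSpace ℝ (Fin d) → ℝ} {p c A B : ℝ≥0∞} {A' B' : ℕ → ℝ≥0∞} {s a : ℝ}
    (ha0 : 0 ≤ a) (ha1 : a ≤ 1) (hc : c ≠ ⊤) (hA : A ≠ ⊤) (hB : B ≠ ⊤)
    (hv : ∀ k, AEStronglyMeasurable (v k) volume)
    (hlim : ∀ᵐ x, Filter.Tendsto (fun k => v k x) Filter.atTop (nhds (u x)))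
    (hA' : Filter.Tendsto A' Filter.atTop (nhds A)) (hB' : Filter.Tendsto B' Filter.atTop (nhds B))
    (h : ∀ k, eLpNorm (fun x => Real.exp (s * theta x) * v k x) p (expThetaMeasure d) ≤
      c * A' k ^ a * B' k ^ (1 - a)) :
    eLpNorm (fun x => Real.exp (s * theta x) * u x) p (expThetaMeasure d) ≤
      c * A ^ a * B ^ (1 - a) := by
  have hac := expThetaMeasure_absolutelyContinuous d
  have hexp : Continuous fun x : EuclideanSpace ℝ (Fin d) => Real.exp (s * theta x) :=
    Real.continuous_exp.comp (continuous_const.mul continuous_theta)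
  have hA2 := ((ENNReal.continuous_rpow_const (y := a)).tendsto A).comp hA'
  have hB2 := ((ENNReal.continuous_rpow_const (y := 1 - a)).tendsto B).comp hB'
  have hAt : A ^ a ≠ ⊤ := ENNReal.rpow_ne_top_of_nonneg ha0 hA
  have hBt : B ^ (1 - a) ≠ ⊤ := ENNReal.rpow_ne_top_of_nonneg (by linarith) hB
  have htend : Filter.Tendsto (fun k => c * A' k ^ a * B' k ^ (1 - a)) Filter.atTop
      (nhds (c * A ^ a * B ^ (1 - a))) :=
    ENNReal.Tendsto.mul (ENNReal.Tendsto.const_mul hA2 (Or.inr hc)) (Or.inr hBt) hB2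
      (Or.inr (ENNReal.mul_ne_top hc hAt))
  calc eLpNorm (fun x => Real.exp (s * theta x) * u x) p (expThetaMeasure d)
      ≤ Filter.atTop.liminf fun k =>
          eLpNorm (fun x => Real.exp (s * theta x) * v k x) p (expThetaMeasure d) := by
        refine Lp.eLpNorm_lim_le_liminf_eLpNorm
          (fun k => (hexp.aestronglyMeasurable.mul (hv k)).mono_ac hac) _ ?_
        filter_upwards [hac.ae_le hlim] with x hx
        exact hx.const_mul _
    _ ≤ Filter.atTop.liminf fun k => c * A' k ^ a * B' k ^ (1 - a) :=
        Filter.liminf_le_liminf (Filter.Eventually.of_forall h)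
    _ = c * A ^ a * B ^ (1 - a) := htend.liminf_eq

/-- The mollifiers: normalized bump functions supported in balls of radius `1 / (k + 1)`. -/
noncomputable def mollifier (d k : ℕ) : ContDiffBump (0 : EuclideanSpace ℝ (Fin d)) where
  rIn := 1 / (2 * (k + 1))
  rOut := 1 / (k + 1)
  rIn_pos := by positivity
  rIn_lt_rOut := one_div_lt_one_div_of_lt (by positivity) (by linarith [k.cast_nonneg (α := ℝ)])

theorem tendsto_mollifier_rOut :
    Filter.Tendsto (fun k => (mollifier d k).rOut) Filter.atTop (nhds 0) :=
  tendsto_one_div_add_atTop_nhds_zero_nat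

/-- Extension from smooth functions to compactly supported Sobolev functions by mollification. -/
theorem weighted_of_support_bounded {p : ℝ≥0∞} {C : ℝ} (hp : p ≠ 0) (ha0 : 0 ≤ gnExponent d p)
    (ha1 : gnExponent d p ≤ 1) (h : SmoothGagliardoNirenberg d p C)
    {u : EuclideanSpace ℝ (Fin d) → ℝ}
    {g : EuclideanSpace ℝ (Fin d) → EuclideanSpace ℝ (Fin d)} (hug : HasWeakGradient u g)
    {R : ℝ} (hR : 0 ≤ R) (hus : ∀ x, R < ‖x‖ → u x = 0) (hgs : ∀ x, R < ‖x‖ → g x = 0)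
    (hu2 : eLpNorm u 2 (expThetaMeasure d) ≠ ⊤) (hg2 : eLpNorm g 2 (expThetaMeasure d) ≠ ⊤) :
    eLpNorm (fun x => Real.exp ((1 / 2 - (p⁻¹).toReal) * theta x) * u x) p (expThetaMeasure d) ≤
      ENNReal.ofReal C * eLpNorm u 2 (expThetaMeasure d) ^ gnExponent d p *
        eLpNorm g 2 (expThetaMeasure d) ^ (1 - gnExponent d p) := by
  set ρ : ℕ → EuclideanSpace ℝ (Fin d) → ℝ := fun k => (mollifier d k).normed volume
  have hρ : ∀ k, ContDiff ℝ ∞ (ρ k) := fun k => (mollifier d k).contDiff_normed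
  have hρc : ∀ k, HasCompactSupport (ρ k) := fun k => (mollifier d k).hasCompactSupport_normed
  have hρ0 : ∀ k x, 0 ≤ ρ k x := fun k x => (mollifier d k).nonneg_normed x
  have hρ1 : ∀ k, ∫⁻ x, ENNReal.ofReal (ρ k x) = 1 := by
    intro k
    rw [← ofReal_integral_eq_lintegral_ofReal
      ((hρ k).continuous.integrable_of_hasCompactSupport (hρc k)) (ae_of_all _ (hρ0 k)),
      (mollifier d k).integral_normed, ENNReal.ofReal_one]
  set ε : ℕ → ℝ := fun k => (mollifier d k).rOut
  have hρs : ∀ k x, ε k < ‖x‖ → ρ k x = 0 := by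
    intro k x hx
    have h1 : x ∉ Function.support (ρ k) := by
      rw [(mollifier d k).support_normed_eq, mem_ball_zero_iff]
      exact not_lt.2 hx.le
    exact Function.notMem_support.1 h1
  have huc : HasCompactSupport u :=
    HasCompactSupport.intro (isCompact_closedBall 0 R) fun x hx => hus x (by simpa using hx)
  set c : ℕ → ℝ≥0∞ := fun k =>
    ENNReal.ofReal (Real.exp ((2 * R * ε k + ε k ^ 2) / 4)) ^ (1 / 2 : ℝ)
  have hclim : Filter.Tendsto c Filter.atTop (nhds 1) := by
    have h1 : Continuous fun e : ℝ =>
        ENNReal.ofReal (Real.exp ((2 * R * e + e ^ 2) / 4)) ^ (1 / 2 : ℝ) := by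
      refine ENNReal.continuous_rpow_const.comp (ENNReal.continuous_ofReal.comp ?_)
      fun_prop
    have h2 := (h1.tendsto 0).comp (tendsto_mollifier_rOut (d := d))
    have h3 : ENNReal.ofReal (Real.exp ((2 * R * 0 + 0 ^ 2) / 4)) ^ (1 / 2 : ℝ) = 1 := by simp
    rw [h3] at h2
    exact h2
  have hbound : ∀ k {F : Type} [NormedAddCommGroup F] [NormedSpace ℝ F]
      (f : EuclideanSpace ℝ (Fin d) → F), LocallyIntegrable f volume → (∀ x, R < ‖x‖ → f x = 0) →
      eLpNorm (convolution (ρ k) f (ContinuousLinearMap.lsmul ℝ ℝ) volume) 2 (expThetaMeasure d) ≤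
        c k * eLpNorm f 2 (expThetaMeasure d) := by
    intro k F _ _ f hf hfs
    rw [eLpNorm_two_eq_lintegral, eLpNorm_two_eq_lintegral,
      ← ENNReal.mul_rpow_of_nonneg _ _ (by norm_num)]
    exact ENNReal.rpow_le_rpow (lintegral_convolution_sq_le (hρ k).continuous (hρ0 k) (hρ1 k)
      hR (hρs k) hf.aestronglyMeasurable hfs) (by norm_num)
  have hsmooth : ∀ k, ContDiff ℝ 1
      (convolution (ρ k) u (ContinuousLinearMap.lsmul ℝ ℝ) volume) := fun k =>
    (hρc k).contDiff_convolution_left (n := 1) _ ((hρ k).of_le (by exact_mod_cast le_top)) hug.1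
  have hlimA : ∀ A : ℝ≥0∞, Filter.Tendsto (fun k => c k * A) Filter.atTop (nhds A) := by
    intro A
    have := ENNReal.Tendsto.mul_const (b := A) hclim (Or.inl one_ne_zero)
    rwa [one_mul] at this
  refine eLpNorm_le_of_tendsto_ae ha0 ha1 ENNReal.ofReal_ne_top hu2 hg2
    (v := fun k => convolution (ρ k) u (ContinuousLinearMap.lsmul ℝ ℝ) volume)
    (fun k => (hsmooth k).continuous.aestronglyMeasurable) ?_ (hlimA _) (hlimA _) fun k => ?_
  · refine ContDiffBump.ae_convolution_tendsto_right_of_locallyIntegrable (K := 2)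
      tendsto_mollifier_rOut (Filter.Eventually.of_forall fun k => le_of_eq ?_) hug.1
    simp only [mollifier]
    field_simp
  · refine (weighted_of_smoothGagliardoNirenberg hp ha1 h (hsmooth k)
      ((hρc k).convolution _ huc)
      (fun x i => convolution_weakGradient_apply hug (hρ k) (hρc k) x i)).trans ?_
    have h1 : 0 ≤ 1 - gnExponent d p := by linarith
    gcongr
    · exact hbound k u hug.1 hus
    · exact hbound k g hug.2.1 hgs

end Approximation

/-! ### Smooth cutoffs and general Sobolev functions -/

section Cutoff

variable {d : ℕ}

theorem LocallyIntegrable.continuous_smul {F : Type*} [NormedAddCommGroup F] [NormedSpace ℝ F]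
    {f : EuclideanSpace ℝ (Fin d) → F} (hf : LocallyIntegrable f volume)
    {c : EuclideanSpace ℝ (Fin d) → ℝ} (hc : Continuous c) :
    LocallyIntegrable (fun x => c x • f x) volume :=
  locallyIntegrable_iff.2 fun _ hk => (hf.integrableOn_isCompact hk).continuousOn_smul
    hc.continuousOn hk

theorem LocallyIntegrable.smul_continuous {F : Type*} [NormedAddCommGroup F] [NormedSpace ℝ F]
    {f : EuclideanSpace ℝ (Fin d) → ℝ} (hf : LocallyIntegrable f volume)
    {c : EuclideanSpace ℝ (Fin d) → F} (hc : Continuous c) :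
    LocallyIntegrable (fun x => f x • c x) volume :=
  locallyIntegrable_iff.2 fun _ hk => (hf.integrableOn_isCompact hk).smul_continuousOn
    hc.continuousOn hk

theorem LocallyIntegrable.integrable_mul_hasCompactSupport {f : EuclideanSpace ℝ (Fin d) → ℝ}
    (hf : LocallyIntegrable f volume) {c : EuclideanSpace ℝ (Fin d) → ℝ} (hc : Continuous c)
    (hcs : HasCompactSupport c) : Integrable fun x => f x * c x :=
  hf.integrable_smul_right_of_hasCompactSupport hc hcs

theorem LocallyIntegrable.coord {g : EuclideanSpace ℝ (Fin d) → EuclideanSpace ℝ (Fin d)}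
    (hg : LocallyIntegrable g volume) (i : Fin d) : LocallyIntegrable (fun x => g x i) volume :=
  locallyIntegrable_iff.2 fun _ hk =>
    (EuclideanSpace.proj (𝕜 := ℝ) i : EuclideanSpace ℝ (Fin d) →L[ℝ] ℝ).integrable_comp
      (hg.integrableOn_isCompact hk)

theorem gradient_apply_eq_fderiv (c : EuclideanSpace ℝ (Fin d) → ℝ) (x : EuclideanSpace ℝ (Fin d))
    (i : Fin d) : gradient c x i = fderiv ℝ c x (EuclideanSpace.single i 1) := by
  have h : inner ℝ (gradient c x) (EuclideanSpace.single i (1 : ℝ)) =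
      fderiv ℝ c x (EuclideanSpace.single i 1) := InnerProductSpace.toDual_symm_apply
  rw [← h, EuclideanSpace.inner_single_right]
  simp

/-- The product rule for a smooth factor and a weakly differentiable one. -/
theorem HasWeakGradient.smooth_mul {u : EuclideanSpace ℝ (Fin d) → ℝ}
    {g : EuclideanSpace ℝ (Fin d) → EuclideanSpace ℝ (Fin d)} (h : HasWeakGradient u g)
    {c : EuclideanSpace ℝ (Fin d) → ℝ} (hc : ContDiff ℝ ∞ c) :
    HasWeakGradient (fun x => c x * u x) fun x => c x • g x + u x • gradient c x := by
  obtain ⟨hu, hg, hug⟩ := h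
  have hc1 : ContDiff ℝ 1 c := hc.of_le (by exact_mod_cast le_top)
  have hgradc : Continuous (gradient c) :=
    (InnerProductSpace.toDual ℝ (EuclideanSpace ℝ (Fin d))).symm.continuous.comp
      (hc1.continuous_fderiv one_ne_zero)
  refine ⟨LocallyIntegrable.continuous_smul hu hc.continuous,
    (LocallyIntegrable.continuous_smul hg hc.continuous).add
      (LocallyIntegrable.smul_continuous hu hgradc), fun η hη hηc i => ?_⟩
  have hη1 : ContDiff ℝ 1 η := hη.of_le (by exact_mod_cast le_top)
  have hdc : Continuous fun x => fderiv ℝ c x (EuclideanSpace.single i 1) :=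
    (hc1.continuous_fderiv one_ne_zero).clm_apply continuous_const
  have hdη : Continuous fun x => fderiv ℝ η x (EuclideanSpace.single i 1) :=
    (hη1.continuous_fderiv one_ne_zero).clm_apply continuous_const
  have hdηs : HasCompactSupport fun x => fderiv ℝ η x (EuclideanSpace.single i 1) :=
    hηc.fderiv_apply (𝕜 := ℝ) _
  have htest := hug (fun x => c x * η x) (hc.mul hη) hηc.mul_left i
  have hprod : ∀ x, fderiv ℝ (fun x => c x * η x) x (EuclideanSpace.single i 1) =
      c x * fderiv ℝ η x (EuclideanSpace.single i 1) +
        fderiv ℝ c x (EuclideanSpace.single i 1) * η x := by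
    intro x
    have h1 := ((hc1.differentiable one_ne_zero x).hasFDerivAt.mul
      (hη1.differentiable one_ne_zero x).hasFDerivAt).fderiv
    have h1' : fderiv ℝ (fun x => c x * η x) x = _ := h1
    rw [h1']
    simp
    ring
  have i1 : Integrable fun x => u x * (c x * fderiv ℝ η x (EuclideanSpace.single i 1)) :=
    LocallyIntegrable.integrable_mul_hasCompactSupport hu (hc.continuous.mul hdη) hdηs.mul_left
  have i2 : Integrable fun x => u x * (fderiv ℝ c x (EuclideanSpace.single i 1) * η x) :=
    LocallyIntegrable.integrable_mul_hasCompactSupport hu (hdc.mul hη.continuous) hηc.mul_left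
  have i3 : Integrable fun x => g x i * (c x * η x) :=
    LocallyIntegrable.integrable_mul_hasCompactSupport (LocallyIntegrable.coord hg i)
      (hc.continuous.mul hη.continuous) hηc.mul_left
  simp_rw [hprod, mul_add] at htest
  rw [integral_add i1 i2] at htest
  have e1 : ∫ x, c x * u x * fderiv ℝ η x (EuclideanSpace.single i 1) =
      ∫ x, u x * (c x * fderiv ℝ η x (EuclideanSpace.single i 1)) :=
    integral_congr_ae (ae_of_all _ fun x => by ring)
  have e2 : ∫ x, (c x • g x + u x • gradient c x) i * η x =
      (∫ x, g x i * (c x * η x)) +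
        ∫ x, u x * (fderiv ℝ c x (EuclideanSpace.single i 1) * η x) := by
    rw [← integral_add i3 i2]
    refine integral_congr_ae (ae_of_all _ fun x => ?_)
    simp only [PiLp.add_apply, PiLp.smul_apply, smul_eq_mul, gradient_apply_eq_fderiv]
    ring
  rw [e1, e2]
  linarith

/-- The weak gradient is unique up to null sets. -/
theorem HasWeakGradient.ae_eq {u : EuclideanSpace ℝ (Fin d) → ℝ}
    {g g' : EuclideanSpace ℝ (Fin d) → EuclideanSpace ℝ (Fin d)} (h : HasWeakGradient u g)
    (h' : HasWeakGradient u g') : ∀ᵐ x, g x = g' x := by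
  refine ae_eq_of_integral_contDiff_smul_eq h.2.1 h'.2.1 fun η hη hηc => ?_
  have hcoord : ∀ f : EuclideanSpace ℝ (Fin d) → EuclideanSpace ℝ (Fin d),
      LocallyIntegrable f volume → ∀ i, (∫ x, η x • f x) i = ∫ x, f x i * η x := by
    intro f hf i
    have h1 := (EuclideanSpace.proj (𝕜 := ℝ) i : EuclideanSpace ℝ (Fin d) →L[ℝ] ℝ).integral_comp_comm
      (hf.integrable_smul_left_of_hasCompactSupport hη.continuous hηc)
    refine Eq.trans h1.symm (integral_congr_ae (ae_of_all _ fun x => ?_))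
    simp [mul_comm]
  ext i
  rw [hcoord g h.2.1, hcoord g' h'.2.1, ← neg_inj, ← h.2.2 η hη hηc i, h'.2.2 η hη hηc i]

/-- A fixed smooth cutoff function, equal to `1` on the unit ball and supported in the ball of
radius `2`. -/
noncomputable def unitCutoff (d : ℕ) : ContDiffBump (0 : EuclideanSpace ℝ (Fin d)) where
  rIn := 1
  rOut := 2
  rIn_pos := one_pos
  rIn_lt_rOut := one_lt_two

/-- Smooth cutoff functions at scale `k + 1`, with gradients of size `O(1 / (k + 1))`. -/
noncomputable def scaledCutoff (d k : ℕ) (x : EuclideanSpace ℝ (Fin d)) : ℝ :=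
  unitCutoff d (((k : ℝ) + 1)⁻¹ • x)

theorem contDiff_scaledCutoff (k : ℕ) : ContDiff ℝ ∞ (scaledCutoff d k) :=
  (unitCutoff d).contDiff.comp (contDiff_id.const_smul _)

theorem scaledCutoff_eq_one {k : ℕ} {x : EuclideanSpace ℝ (Fin d)} (hx : ‖x‖ ≤ k + 1) :
    scaledCutoff d k x = 1 := by
  refine (unitCutoff d).one_of_mem_closedBall ?_
  rw [mem_closedBall_zero_iff, norm_smul, Real.norm_of_nonneg (by positivity),
    inv_mul_le_iff₀ (by positivity)]
  simpa [unitCutoff] using hx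

theorem scaledCutoff_eventuallyEq_zero {k : ℕ} {x : EuclideanSpace ℝ (Fin d)}
    (hx : 2 * ((k : ℝ) + 1) < ‖x‖) : scaledCutoff d k =ᶠ[nhds x] fun _ => 0 := by
  have hopen : IsOpen {y : EuclideanSpace ℝ (Fin d) | 2 * ((k : ℝ) + 1) < ‖y‖} :=
    isOpen_lt continuous_const continuous_norm
  filter_upwards [hopen.mem_nhds hx] with y hy
  refine (unitCutoff d).zero_of_le_dist ?_
  rw [dist_zero_right, norm_smul, Real.norm_of_nonneg (by positivity), le_inv_mul_iff₀ (by positivity)]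
  simp only [unitCutoff]
  have : 2 * ((k : ℝ) + 1) < ‖y‖ := hy
  linarith

theorem abs_scaledCutoff_le_one (k : ℕ) (x : EuclideanSpace ℝ (Fin d)) :
    |scaledCutoff d k x| ≤ 1 := by
  unfold scaledCutoff
  rw [abs_of_nonneg (unitCutoff d).nonneg]
  exact (unitCutoff d).le_one

theorem exists_norm_gradient_scaledCutoff_le (d : ℕ) :
    ∃ M : ℝ, ∀ k x, ‖gradient (scaledCutoff d k) x‖ ≤ M * ((k : ℝ) + 1)⁻¹ := by
  have hc : ContDiff ℝ 1 (unitCutoff d) := (unitCutoff d).contDiff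
  obtain ⟨M, hM⟩ := ((unitCutoff d).hasCompactSupport.fderiv ℝ).exists_bound_of_continuous
    (hc.continuous_fderiv one_ne_zero)
  refine ⟨M, fun k x => ?_⟩
  have h1 : HasFDerivAt (scaledCutoff d k) _ x :=
    (hc.differentiable one_ne_zero (((k : ℝ) + 1)⁻¹ • x)).hasFDerivAt.comp x
      ((hasFDerivAt_id x).const_smul (((k : ℝ) + 1)⁻¹))
  have h2 : ‖gradient (scaledCutoff d k) x‖ = ‖fderiv ℝ (scaledCutoff d k) x‖ :=
    (InnerProductSpace.toDual ℝ (EuclideanSpace ℝ (Fin d))).symm.norm_map _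
  have h3 : fderiv ℝ (scaledCutoff d k) x =
      ((k : ℝ) + 1)⁻¹ • fderiv ℝ (unitCutoff d) (((k : ℝ) + 1)⁻¹ • x) := by
    rw [h1.fderiv]
    ext v
    simp
  rw [h2, h3, norm_smul, Real.norm_of_nonneg (by positivity), mul_comm]
  exact mul_le_mul_of_nonneg_right (hM _) (by positivity)

/-- Extension to all of `H¹(e^θ)`: cut off at scale `k + 1`; the error term `u ∇χ` in the gradient
of the product is `O(1/k)` in `L²(e^θ)`. The norm of `g` is finite because weak gradients are
unique. -/
theorem weightedGagliardoNirenberg_of_smooth {p : ℝ≥0∞} {C : ℝ} (hp : 2 ≤ p)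
    (ha0 : 0 ≤ gnExponent d p) (ha1 : gnExponent d p ≤ 1) (h : SmoothGagliardoNirenberg d p C) :
    WeightedGagliardoNirenberg d p C := by
  rintro u g ⟨hu2, g', hg', hg2'⟩ hg
  have hac := expThetaMeasure_absolutelyContinuous d
  have hp0 : p ≠ 0 := (two_pos.trans_le hp).ne'
  have hg2 : eLpNorm g 2 (expThetaMeasure d) ≠ ⊤ := by
    rw [eLpNorm_congr_ae (hac.ae_le (hg.ae_eq hg'))]
    exact hg2'.eLpNorm_ne_top
  have hy : (p⁻¹).toReal ≤ 1 / 2 := by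
    have := ENNReal.toReal_mono (by simp) (ENNReal.inv_le_inv.2 hp)
    simpa using this
  refine ⟨eLpNorm_mono fun x => ?_, ?_⟩
  · rw [norm_mul, Real.norm_of_nonneg (Real.exp_pos _).le]
    refine le_mul_of_one_le_left (norm_nonneg _) (Real.one_le_exp ?_)
    exact mul_nonneg (by linarith) (theta_nonneg x)
  obtain ⟨M, hM⟩ := exists_norm_gradient_scaledCutoff_le d
  set A := eLpNorm u 2 (expThetaMeasure d)
  set B := eLpNorm g 2 (expThetaMeasure d)
  have hA : A ≠ ⊤ := hu2.eLpNorm_ne_top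
  have hcd := contDiff_scaledCutoff (d := d)
  have hBlim : Filter.Tendsto (fun k : ℕ => B + ENNReal.ofReal (M * ((k : ℝ) + 1)⁻¹) * A)
      Filter.atTop (nhds B) := by
    have h1 : Filter.Tendsto (fun k : ℕ => M * ((k : ℝ) + 1)⁻¹) Filter.atTop (nhds 0) := by
      have := (tendsto_one_div_add_atTop_nhds_zero_nat (𝕜 := ℝ)).const_mul M
      simpa using this
    have h2 := ENNReal.Tendsto.mul_const (b := A) (ENNReal.tendsto_ofReal h1) (Or.inr hA)
    simpa using h2.const_add B
  have hA' : ∀ k, eLpNorm (fun x => scaledCutoff d k x * u x) 2 (expThetaMeasure d) ≤ A := by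
    refine fun k => eLpNorm_mono fun x => ?_
    rw [norm_mul]
    exact mul_le_of_le_one_left (norm_nonneg _) (abs_scaledCutoff_le_one k x)
  have hB' : ∀ k, eLpNorm (fun x => scaledCutoff d k x • g x + u x • gradient (scaledCutoff d k) x)
      2 (expThetaMeasure d) ≤ B + ENNReal.ofReal (M * ((k : ℝ) + 1)⁻¹) * A := by
    intro k
    have hgradc : Continuous (gradient (scaledCutoff d k)) :=
      (InnerProductSpace.toDual ℝ (EuclideanSpace ℝ (Fin d))).symm.continuous.comp
        (((hcd k).of_le (by exact_mod_cast le_top) : ContDiff ℝ 1 _).continuous_fderiv one_ne_zero)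
    have m1 : AEStronglyMeasurable (fun x => scaledCutoff d k x • g x) (expThetaMeasure d) :=
      ((hcd k).continuous.aestronglyMeasurable.smul hg.2.1.aestronglyMeasurable).mono_ac hac
    have m2 : AEStronglyMeasurable (fun x => u x • gradient (scaledCutoff d k) x)
        (expThetaMeasure d) :=
      (hg.1.aestronglyMeasurable.smul hgradc.aestronglyMeasurable).mono_ac hac
    refine (eLpNorm_add_le m1 m2 one_le_two).trans (add_le_add (eLpNorm_mono fun x => ?_) ?_)
    · rw [norm_smul]
      exact mul_le_of_le_one_left (norm_nonneg _) (abs_scaledCutoff_le_one k x)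
    · refine eLpNorm_le_mul_eLpNorm_of_ae_le_mul (ae_of_all _ fun x => ?_) 2
      rw [norm_smul, mul_comm]
      exact mul_le_mul_of_nonneg_right (hM k x) (norm_nonneg _)
  refine eLpNorm_le_of_tendsto_ae ha0 ha1 ENNReal.ofReal_ne_top hA hg2
    (v := fun k x => scaledCutoff d k x * u x)
    (fun k => (hcd k).continuous.aestronglyMeasurable.mul hg.1.aestronglyMeasurable)
    (ae_of_all _ fun x => ?_) (tendsto_const_nhds (x := A)) hBlim fun k => ?_
  · refine tendsto_const_nhds.congr' ?_
    filter_upwards [Filter.eventually_ge_atTop ⌈‖x‖⌉₊] with k hk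
    rw [scaledCutoff_eq_one ((Nat.ceil_le.1 hk).trans (by linarith)), one_mul]
  · refine (weighted_of_support_bounded hp0 ha0 ha1 h (hg.smooth_mul (hcd k))
      (R := 2 * ((k : ℝ) + 1)) (by positivity) (fun x hx => ?_) (fun x hx => ?_)
      (ne_top_of_le_ne_top hA (hA' k)) (ne_top_of_le_ne_top (ENNReal.add_ne_top.2
        ⟨hg2, ENNReal.mul_ne_top ENNReal.ofReal_ne_top hA⟩) (hB' k))).trans ?_
    · simp [(scaledCutoff_eventuallyEq_zero hx).eq_of_nhds]
    · have h0 := scaledCutoff_eventuallyEq_zero hx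
      have h1 : gradient (scaledCutoff d k) x = 0 := by
        rw [gradient, h0.fderiv_eq]
        simp
      simp [h0.eq_of_nhds, h1]
    · have h1 : 0 ≤ 1 - gnExponent d p := by linarith
      gcongr
      · exact hA' k
      · exact hB' k

end Cutoff

theorem gnExponent_le_one {d : ℕ} {p : ℝ≥0∞} (hp : 2 ≤ p) : gnExponent d p ≤ 1 := by
  have hy : (p⁻¹).toReal ≤ 1 / 2 := by
    have := ENNReal.toReal_mono (by simp) (ENNReal.inv_le_inv.2 hp)
    simpa using this
  have : (d : ℝ) * ((p⁻¹).toReal - 1 / 2) ≤ 0 :=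
    mul_nonpos_of_nonneg_of_nonpos (Nat.cast_nonneg d) (by linarith)
  unfold gnExponent
  linarith

theorem gnExponent_nonneg_of_le {d : ℕ} (hd : 3 ≤ d) {p : ℝ≥0∞} (hp : 2 ≤ p)
    (hpd : p ≤ ENNReal.ofReal (2 * (d : ℝ) / ((d : ℝ) - 2))) : 0 ≤ gnExponent d p := by
  have hd3 : (3 : ℝ) ≤ d := by exact_mod_cast hd
  have hd2 : (0 : ℝ) < d - 2 := by linarith
  have hd0 : (0 : ℝ) < d := by linarith
  have hpt : p ≠ ⊤ := (hpd.trans_lt ENNReal.ofReal_lt_top).ne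
  have hr2 : 2 ≤ p.toReal := by simpa using ENNReal.toReal_mono hpt hp
  have hrq : p.toReal ≤ 2 * (d : ℝ) / (d - 2) := by
    have := ENNReal.toReal_mono ENNReal.ofReal_ne_top hpd
    rwa [ENNReal.toReal_ofReal (by positivity)] at this
  have h1 : 1 / (2 * (d : ℝ) / (d - 2)) ≤ 1 / p.toReal :=
    one_div_le_one_div_of_le (by linarith) hrq
  have h2 : (d : ℝ) * (1 / 2 - 1 / (2 * (d : ℝ) / (d - 2))) = 1 := by field_simp; ring
  rw [gnExponent, ENNReal.toReal_inv, ← one_div]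
  nlinarith [mul_le_mul_of_nonneg_left h1 hd0.le]

theorem lemma2p5 :
    (∀ p : ℝ≥0∞, 2 ≤ p →
      WeightedGagliardoNirenberg 1 p ((2 : ℝ) ^ ((1 : ℝ) / 2 - (p⁻¹).toReal))) ∧
    (∀ (p : ℝ≥0∞) (k : ℕ) (r : ℝ), 2 ≤ p → p < ⊤ → 1 ≤ k → 0 ≤ r → r < 1 →
      p.toReal = 2 * ((k : ℝ) + r) →
      WeightedGagliardoNirenberg 2 p
        (((k ! : ℕ) : ℝ) ^ (1 / ((k : ℝ) + r)) * ((k : ℝ) + 1) ^ (r / ((k : ℝ) + r)))) ∧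
    (∀ (d : ℕ) (p : ℝ≥0∞), 3 ≤ d → 2 ≤ p →
      p ≤ ENNReal.ofReal (2 * (d : ℝ) / ((d : ℝ) - 2)) →
      WeightedGagliardoNirenberg d p
        ((1 / ((d : ℝ) * ((d : ℝ) - 2) * Real.pi)) ^ ((1 - gnExponent d p) / 2) *
          ((((d - 1) ! : ℕ) : ℝ) / Real.Gamma ((d : ℝ) / 2)) ^
            ((1 : ℝ) / 2 - (p⁻¹).toReal))) := by
  refine ⟨fun p hp => ?_, fun p k r hp hpt hk hr0 hr1 hpk => ?_, fun d p hd hp hpd => ?_⟩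
  · refine weightedGagliardoNirenberg_of_smooth hp ?_ (gnExponent_le_one hp)
      (smoothGagliardoNirenberg_one hp)
    have : 0 ≤ (p⁻¹).toReal := ENNReal.toReal_nonneg
    unfold gnExponent
    push_cast
    linarith
  · refine weightedGagliardoNirenberg_of_smooth hp ?_ (gnExponent_le_one hp)
      (smoothGagliardoNirenberg_two hp hpt hk hr0 hr1 hpk)
    have : 0 ≤ (p⁻¹).toReal := ENNReal.toReal_nonneg
    unfold gnExponent
    push_cast
    linarith
  · exact weightedGagliardoNirenberg_of_smooth hp (gnExponent_nonneg_of_le hd hp hpd)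
      (gnExponent_le_one hp) (smoothGagliardoNirenberg_of_three_le hd hp hpd)
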